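/- Throughout, $e(H)$ and $v(H)$ denote the numbers of edges and vertices of a graph $H$. A *pseudoforest* is a graph in which every connected component contains at most one cycle. A *decomposition* of a graph $G$ into $m$ pseudoforests is a partition of the edge set of $G$ into $m$ (possibly empty) classes, each of which forms a pseudoforest on the vertex set of $G$. The *fractional arboricity* of a finite graph $G$ is $\max \frac{e(H)}{v(H)-1}$ over all subgraphs $H \subseteq G$ with $v(H) \ge 2$ (and $0$ if $v(G) \le 1$). The *diameter* $\mathrm{diam}(K)$ of a connected graph $K$ is the maximum distance between two of its vertices. **Theorem.** Let $k, D, d, z \in \mathbb N = \{0,1,2,\dots\}$ and let $\varepsilon > 0$ be real, with $k \ge 2$ and $z \le \left\lfloor \frac{d-1}{k+1} \right\rfloor$ (so in particular $d \ge 1$). Then there is a finite simple graph $G$ whose fractional arboricity is less than $k + \frac{d}{d+k+1} + \varepsilon$ and which has the following property: in every decomposition of $G$ into $k+1$ pseudoforests and for every pseudoforest $F$ of this decomposition that has maximum degree at most $D$, there is a connected component $K$ of $F$ with $$e(K) \ge d - z(k-1) + 1 \quad\text{and}\quad \mathrm{diam}(K) \ge 2(z+1).$$ -/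

import Mathlib

/-- A graph is a pseudoforest if each connected component contains at most one cycle: any two
cycles lying in the same component are the same subgraph. -/
def SimpleGraph.IsPseudoforest {V : Type*} (F : SimpleGraph V) : Prop :=
  ∀ ⦃u v : V⦄ (p : F.Walk u u) (q : F.Walk v v),
    p.IsCycle → q.IsCycle → F.Reachable u v → p.toSubgraph = q.toSubgraph

/-- The (spanning) graphs `F i` decompose `G`: their edge sets are pairwise disjoint and their union
is the edge set of `G`. As usual, parts without edges are allowed. -/
def SimpleGraph.IsDecomposition {V ι : Type*} (G : SimpleGraph V) (F : ι → SimpleGraph V) : Prop :=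
  (Pairwise fun i j => Disjoint (F i).edgeSet (F j).edgeSet) ∧
    ⋃ i, (F i).edgeSet = G.edgeSet

/-- The fractional arboricity of a finite graph `G`: the maximum of `e(H) / (v(H) - 1)` over all
subgraphs `H` of `G` with `v(H) ≥ 2` (only finitely many values, so the supremum is a maximum;
it is `0` by convention if `G` has fewer than two vertices). -/
noncomputable def SimpleGraph.fractionalArboricity {V : Type*} (G : SimpleGraph V) : ℝ :=
  sSup {r : ℝ | ∃ H : G.Subgraph, 2 ≤ H.verts.ncard ∧
    r = (H.edgeSet.ncard : ℝ) / ((H.verts.ncard : ℝ) - 1)}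

/-! ### Forests, pseudoforests, and the size and diameter of components. -/

namespace SimpleGraph

variable {V : Type*}

/-! `G` consists of `k` hubs and many disjoint copies of a gadget `X`; each hub is joined to the
*rigid* vertices of all copies. A pseudoforest has at most as many edges as vertices, so up to a
bounded error the `k` other parts leave to `F` on average `e(X) + k * #rigid - k * v(X)` edges per
copy. Having bounded degree, `F` uses hub edges at boundedly many copies only. Hence in some copy
`F` uses no hub edge and has at least that many edges (`hubGraph.exists_copy`); components of `F`
meeting that copy stay inside it.

Put `b = d - (k+1)z - 1`. The gadget has `N` centres, each with `b` leaves and `k` private paths on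
`z+1` vertices, and `N` shared paths, each attached by its first vertex to `k+1` centres; one extra
private path hangs at the centre `1`. Only centres and first vertices of shared paths are not rigid.
With `U = (k+1)N + 1` paths, the edge count above is `v(X) - U + 1`. So if `F` is a forest in the
copy, it has fewer than `U` components there, and some contain the far ends (tips) of two paths,
which forces diameter at least `2(z+1)`. Such a component with fewer than `2z+2+b = d - z(k-1) + 1`
edges must miss leaves of its centres; these isolated leaves are components themselves and
compensate for the surplus tips (`card_tips_le`). Hence the components with several tips cannot all
be small. If `F` has a cycle in the copy, the large girth of `X` finishes the argument
(`exists_large_component`).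

For the fractional arboricity, a hub in the subgraph cancels the `-1` in the denominator, and it
remains to bound the edges inside a vertex set `S` of `X` by `k * #nonrigid + (d/(d+k+1) + ε/2) *
|S|`. Without the extra path, `S = V(X)` gives equality at `ε = 0`. The extra path causes an excess
of at most a constant, and only when the centres and shared paths in `S` are closed under adjacency,
which forces `S` to be large (`mul_edgesIn_le`). Centres and shared paths are both indexed by a
group containing involutions (flips) without short relations, which yields both the girth and this
largeness. -/

theorem ConnectedComponent.sum_card_supp [Fintype V] (F : SimpleGraph V)
    [Fintype F.ConnectedComponent] :
    ∑ K : F.ConnectedComponent, K.supp.ncard = Fintype.card V := by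
  classical
  have h := Finset.card_eq_sum_card_fiberwise (s := (Finset.univ : Finset V))
    (t := (Finset.univ : Finset F.ConnectedComponent)) (f := F.connectedComponentMk)
    (fun _ _ => Finset.mem_coe.2 (Finset.mem_univ _))
  rw [← Finset.card_univ, h]
  refine Finset.sum_congr rfl fun K _ => ?_
  rw [← Set.ncard_coe_finset]
  congr 1
  ext v
  simp [ConnectedComponent.supp]

theorem ncard_edgeSet_le_sum_component [Finite V] (F : SimpleGraph V)
    [Fintype F.ConnectedComponent] :
    F.edgeSet.ncard ≤ ∑ K : F.ConnectedComponent, K.toSimpleGraph.edgeSet.ncard := by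
  classical
  have hsub : F.edgeSet ⊆ ⋃ K ∈ (Finset.univ : Finset F.ConnectedComponent),
      (Sym2.map Subtype.val) '' K.toSimpleGraph.edgeSet := by
    intro e
    induction e with | _ u v
    intro huv
    simp only [Set.mem_iUnion]
    refine ⟨F.connectedComponentMk u, Finset.mem_univ _, s(⟨u, rfl⟩, ⟨v, ?_⟩), ?_, rfl⟩
    · exact ConnectedComponent.sound (Adj.reachable huv).symm
    · exact huv
  refine (Set.ncard_le_ncard hsub (Set.toFinite _)).trans ?_
  refine (Finset.set_ncard_biUnion_le _ _).trans ?_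
  exact Finset.sum_le_sum fun K _ => Set.ncard_image_le (Set.toFinite _)

theorem IsAcyclic.ncard_edgeSet_add_card_component_le [Finite V] {F : SimpleGraph V}
    (hF : F.IsAcyclic) :
    F.edgeSet.ncard + Nat.card F.ConnectedComponent ≤ Nat.card V := by
  classical
  have := Fintype.ofFinite V
  have := Fintype.ofFinite F.ConnectedComponent
  have h1 := F.ncard_edgeSet_le_sum_component
  have h2 := ConnectedComponent.sum_card_supp F
  have h3 : ∀ K : F.ConnectedComponent, K.toSimpleGraph.edgeSet.ncard + 1 = K.supp.ncard := by
    intro K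
    have hT := (hF.isTree_connectedComponent K)
    have := (isTree_iff_connected_and_card.1 hT).2
    rw [← Nat.card_coe_set_eq, ← Nat.card_coe_set_eq]
    exact this
  rw [Nat.card_eq_fintype_card, Nat.card_eq_fintype_card, ← h2]
  have h4 : ∑ K : F.ConnectedComponent, K.supp.ncard
      = ∑ K : F.ConnectedComponent, K.toSimpleGraph.edgeSet.ncard
        + Fintype.card F.ConnectedComponent := by
    rw [Finset.sum_congr rfl fun K _ => (h3 K).symm, Finset.sum_add_distrib]
    simp
  omega

/-- One edge per component meets every cycle in it. Deleting these edges leaves a forest, with at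
least as many components as before, so the forest bound pays for the deleted edges. -/
theorem IsPseudoforest.ncard_edgeSet_le [Finite V] {F : SimpleGraph V} (hF : F.IsPseudoforest) :
    F.edgeSet.ncard ≤ Nat.card V := by
  classical
  have := Fintype.ofFinite F.ConnectedComponent
  have hex : ∀ K : F.ConnectedComponent, ∃ B : Set (Sym2 V), B.ncard ≤ 1 ∧
      ∀ (u : V) (p : F.Walk u u), p.IsCycle → F.connectedComponentMk u = K →
        ∃ e ∈ B, e ∈ p.edges := by
    intro K
    by_cases h : ∃ (u : V) (p : F.Walk u u), p.IsCycle ∧ F.connectedComponentMk u = K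
    · obtain ⟨u, p, hp, hu⟩ := h
      obtain ⟨e, he⟩ : ∃ e, e ∈ p.edges := by
        have := hp.three_le_length
        rw [← Walk.length_edges] at this
        exact List.exists_mem_of_length_pos (by omega)
      refine ⟨{e}, by simp, fun v q hq hv => ⟨e, rfl, ?_⟩⟩
      have := hF p q hp hq (ConnectedComponent.exact (hu.trans hv.symm))
      rw [← Walk.mem_edges_toSubgraph] at he ⊢
      rwa [← this]
    · refine ⟨∅, by simp, fun v q hq hv => (h ⟨v, q, hq, hv⟩).elim⟩
  choose B hB1 hB2 using hex
  let R : Set (Sym2 V) := ⋃ K ∈ (Finset.univ : Finset F.ConnectedComponent), B K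
  have hR : R.ncard ≤ Nat.card F.ConnectedComponent := by
    refine (Finset.set_ncard_biUnion_le _ _).trans ?_
    refine (Finset.sum_le_sum fun K _ => hB1 K).trans ?_
    simp [Nat.card_eq_fintype_card]
  have hac : (F.deleteEdges R).IsAcyclic := by
    intro u p hp
    have hle : F.deleteEdges R ≤ F := deleteEdges_le R
    obtain ⟨e, heB, hep⟩ := hB2 _ u (p.mapLe hle) (hp.mapLe hle) rfl
    have : e ∈ p.edges := by simpa using hep
    have := p.edges_subset_edgeSet this
    rw [edgeSet_deleteEdges] at this
    refine this.2 ?_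
    simp only [R, Set.mem_iUnion]
    exact ⟨_, Finset.mem_univ _, heB⟩
  have h1 := hac.ncard_edgeSet_add_card_component_le
  have h2 : Nat.card F.ConnectedComponent ≤ Nat.card (F.deleteEdges R).ConnectedComponent := by
    refine Nat.card_le_card_of_surjective
      (ConnectedComponent.map (Hom.ofLE (deleteEdges_le R))) ?_
    intro K
    induction K using ConnectedComponent.ind with | _ v
    exact ⟨(F.deleteEdges R).connectedComponentMk v, rfl⟩
  have h3 : F.edgeSet.ncard ≤ (F.deleteEdges R).edgeSet.ncard + R.ncard := by
    rw [edgeSet_deleteEdges]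
    exact Set.ncard_le_ncard_sdiff_add_ncard _ _ (Set.toFinite _)
  omega

/-- In a graph all of whose cycles are long, a cycle contains two vertices far apart. -/
theorem Walk.IsCycle.exists_le_dist [DecidableEq V] {F : SimpleGraph V} {n : ℕ}
    (hn : 0 < n)
    (hg : ∀ (u : V) (p : F.Walk u u), p.IsCycle → 2 * n ≤ p.length)
    {u : V} {w : F.Walk u u} (hw : w.IsCycle) :
    ∃ v, F.Reachable u v ∧ n ≤ F.dist u v := by
  -- If the vertex `n` steps along the cycle were nearer than `n`, the arc and a shortest path would
  -- span fewer than `2 * n` edges, hence a forest; but paths in a forest are unique, and these two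
  -- differ in length.
  refine ⟨w.getVert n, (w.take n).reachable, ?_⟩
  by_contra! hlt
  have hlen := hg u w hw
  have hp : (w.take n).IsPath := hw.isPath_take (by omega)
  obtain ⟨q, hq, hql⟩ := (w.take n).reachable.exists_path_of_dist
  have hpl : (w.take n).length = n := by rw [Walk.take_length]; omega
  set p := w.take n with hpdef
  let S : Set (Sym2 V) := {e | e ∈ p.edges ++ q.edges}
  let H : SimpleGraph V := fromEdgeSet S
  have hHp : ∀ e ∈ p.edges, e ∈ H.edgeSet := fun e he => by
    rw [edgeSet_fromEdgeSet]
    exact ⟨List.mem_append_left _ he, F.not_isDiag_of_mem_edgeSet (p.edges_subset_edgeSet he)⟩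
  have hHq : ∀ e ∈ q.edges, e ∈ H.edgeSet := fun e he => by
    rw [edgeSet_fromEdgeSet]
    exact ⟨List.mem_append_right _ he, F.not_isDiag_of_mem_edgeSet (q.edges_subset_edgeSet he)⟩
  have hHF : H ≤ F := by
    intro x y hxy
    rw [fromEdgeSet_adj] at hxy
    rcases List.mem_append.1 hxy.1 with h | h
    · exact p.edges_subset_edgeSet h
    · exact q.edges_subset_edgeSet h
  have hH : H.IsAcyclic := by
    intro x c hc
    have h1 := hg x (c.mapLe hHF) (hc.mapLe hHF)
    have h2 : c.edges.toFinset ⊆ (p.edges ++ q.edges).toFinset := by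
      intro e he
      have := c.edges_subset_edgeSet (List.mem_toFinset.1 he)
      rw [edgeSet_fromEdgeSet] at this
      exact List.mem_toFinset.2 this.1
    have h3 := Finset.card_le_card h2
    rw [List.toFinset_card_of_nodup hc.edges_nodup, Walk.length_edges] at h3
    have h4 := List.toFinset_card_le (p.edges ++ q.edges)
    rw [List.length_append, Walk.length_edges, Walk.length_edges] at h4
    simp at h1
    omega
  have := (hH.subsingleton_path _ _).elim
    ⟨p.transfer H hHp, hp.transfer hHp⟩ ⟨q.transfer H hHq, hq.transfer hHq⟩
  have h5 : (p.transfer H hHp).length = (q.transfer H hHq).length := by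
    rw [Subtype.mk.inj this]
  rw [Walk.length_transfer, Walk.length_transfer] at h5
  omega

theorem ConnectedComponent.le_diam_toSimpleGraph [Finite V] {F : SimpleGraph V}
    (K : F.ConnectedComponent) {u v : V} (hu : u ∈ K.supp) (hv : v ∈ K.supp) :
    F.dist u v ≤ K.toSimpleGraph.diam := by
  have hc := K.connected_toSimpleGraph
  have : Nonempty K := ⟨⟨u, hu⟩⟩
  have h1 : K.toSimpleGraph.dist ⟨u, hu⟩ ⟨v, hv⟩ ≤ K.toSimpleGraph.diam :=
    dist_le_diam (connected_iff_ediam_ne_top.1 hc)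
  obtain ⟨p, hp⟩ := hc.exists_walk_length_eq_dist ⟨u, hu⟩ ⟨v, hv⟩
  have h2 := dist_le (p.map K.toSimpleGraph_hom)
  rw [Walk.length_map] at h2
  exact h2.trans (hp.le.trans h1)

theorem ConnectedComponent.ncard_supp_le [Finite V] {F : SimpleGraph V}
    (K : F.ConnectedComponent) : K.supp.ncard ≤ K.toSimpleGraph.edgeSet.ncard + 1 := by
  have := K.connected_toSimpleGraph.card_vert_le_card_edgeSet_add_one
  rwa [Nat.card_coe_set_eq] at this

theorem Walk.IsCycle.length_le_ncard_supp [Finite V] {F : SimpleGraph V} {u : V}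
    {w : F.Walk u u} (hw : w.IsCycle) : w.length ≤ (F.connectedComponentMk u).supp.ncard := by
  classical
  have h1 : (w.support.tail.toFinset : Set V) ⊆ (F.connectedComponentMk u).supp := by
    intro x hx
    have hx' : x ∈ w.support := List.mem_of_mem_tail (List.mem_toFinset.1 hx)
    exact ConnectedComponent.sound (w.takeUntil x hx').reachable.symm
  have h2 := Set.ncard_le_ncard h1 (Set.toFinite _)
  rw [Set.ncard_coe_finset, List.toFinset_card_of_nodup hw.support_nodup] at h2
  simpa using h2

/-- A component of the preimage of `F` under an embedding whose range is closed under adjacency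
is isomorphic to a component of `F`. -/
theorem ConnectedComponent.exists_iso_of_comap {V' : Type*} {F : SimpleGraph V} (f : V' ↪ V)
    (hf : ∀ x v, F.Adj (f x) v → v ∈ Set.range f) (K' : (F.comap f).ConnectedComponent) :
    ∃ K : F.ConnectedComponent, Nonempty (K'.toSimpleGraph ≃g K.toSimpleGraph) := by
  induction K' using ConnectedComponent.ind with | _ x
  -- Walks of `F` starting in the range of `f` never leave it, so they lift.
  have hwalk : ∀ (a b : V), F.Walk a b → ∀ y, f y = a → ∃ y', f y' = b ∧
      (F.comap f).Reachable y y' := by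
    intro a b p
    induction p with
    | nil => exact fun y hy => ⟨y, hy, Reachable.refl _⟩
    | cons h p ih =>
      intro y hy
      subst hy
      obtain ⟨y1, hy1⟩ := hf y _ h
      obtain ⟨y', hy', hr⟩ := ih y1 hy1
      refine ⟨y', hy', Reachable.trans (Adj.reachable ?_) hr⟩
      rw [comap_adj, hy1]
      exact h
  have hmem : ∀ y, y ∈ ((F.comap f).connectedComponentMk x).supp ↔
      f y ∈ (F.connectedComponentMk (f x)).supp := by
    intro y
    simp only [ConnectedComponent.mem_supp_iff, ConnectedComponent.eq]
    constructor
    · exact fun h => h.map (Embedding.comap f F).toHom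
    · intro h
      obtain ⟨p⟩ := h.symm
      obtain ⟨y', hy', hr⟩ := hwalk _ _ p x rfl
      rw [← f.injective hy']
      exact hr.symm
  refine ⟨F.connectedComponentMk (f x), ⟨⟨Equiv.ofBijective
    (fun y => ⟨f y.1, (hmem y.1).1 y.2⟩) ⟨?_, ?_⟩, ?_⟩⟩⟩
  · intro y y' h
    exact Subtype.ext (f.injective (Subtype.mk.inj h))
  · rintro ⟨v, hv⟩
    obtain ⟨p⟩ := (ConnectedComponent.exact hv).symm
    obtain ⟨y', hy', -⟩ := hwalk _ _ p x rfl
    subst hy'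
    exact ⟨⟨y', (hmem y').2 hv⟩, rfl⟩
  · intro y y'
    rfl

theorem Iso.ncard_edgeSet_eq {V' : Type*} {F : SimpleGraph V} {F' : SimpleGraph V'}
    (φ : F ≃g F') : F.edgeSet.ncard = F'.edgeSet.ncard := by
  rw [← Nat.card_coe_set_eq, ← Nat.card_coe_set_eq]
  exact Nat.card_congr φ.mapEdgeSet

theorem Iso.ediam_le {V' : Type*} {F : SimpleGraph V} {F' : SimpleGraph V'}
    (φ : F ≃g F') : F'.ediam ≤ F.ediam := by
  refine ediam_le_of_edist_le fun u v => ?_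
  refine le_trans ?_ (edist_le_ediam (u := φ.symm u) (v := φ.symm v))
  refine le_iInf fun w => ?_
  simpa using (w.map φ.toHom).edist_le

theorem Iso.diam_eq {V' : Type*} {F : SimpleGraph V} {F' : SimpleGraph V'}
    (φ : F ≃g F') : F.diam = F'.diam := by
  rw [SimpleGraph.diam, SimpleGraph.diam, le_antisymm φ.symm.ediam_le φ.ediam_le]

end SimpleGraph

/-! ### Involutions without short relations, acting on a ball of a regular tree. -/

/-- The reduced words of length at most `r` over the letters `Fin n`. -/
def ReducedWord (n r : ℕ) : Type :=
  {l : List (Fin n) // l.IsChain (· ≠ ·) ∧ l.length ≤ r}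

namespace ReducedWord

variable {n r : ℕ}

instance : Finite (ReducedWord n r) :=
  Set.Finite.to_subtype ((List.finite_length_le (Fin n) r).subset fun _ hl => hl.2)

def nil : ReducedWord n r := ⟨[], by simp⟩

/-- Cancel the letter `i` at the front of a word, or else prepend it if there is room. -/
def flipFun (i : Fin n) (w : ReducedWord n r) : ReducedWord n r :=
  if h : w.1.head? = some i then ⟨w.1.tail, w.2.1.tail, by simp; have := w.2.2; omega⟩
  else if h' : w.1.length < r then
    ⟨i :: w.1, by
      rw [List.isChain_cons]
      refine ⟨fun y hy => ?_, w.2.1⟩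
      rintro rfl
      exact h hy, by simpa using h'⟩
  else w

theorem flipFun_involutive (i : Fin n) :
    Function.Involutive (flipFun i : ReducedWord n r → ReducedWord n r) := by
  rintro ⟨l, hl, hr⟩
  cases l with
  | nil =>
    by_cases h : 0 < r <;> simp [flipFun, h] <;> rfl
  | cons a l =>
    by_cases ha : a = i
    · subst ha
      have h1 : ¬ (l.head? = some a) := by
        intro h
        rw [List.isChain_cons] at hl
        exact hl.1 a h rfl
      have h2 : l.length < r := by simpa using hr
      simp [flipFun, h1, h2]
      rfl
    · by_cases h : l.length + 1 < r <;> simp [flipFun, h, ha] <;> rfl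

def flip (i : Fin n) : Equiv.Perm (ReducedWord n r) :=
  (flipFun_involutive i).toPerm

theorem flip_mul_flip (i : Fin n) : (flip i * flip i : Equiv.Perm (ReducedWord n r)) = 1 := by
  ext w : 1
  exact flipFun_involutive i w

/-- The letters are prepended one by one, last letter first, and reducedness prevents cancellation.
So a product of at most `r` flips along a reduced word determines that word. -/
theorem prod_flip_apply_nil (l : List (Fin n)) (hl : l.IsChain (· ≠ ·)) (hr : l.length ≤ r) :
    (l.map flip).prod (nil : ReducedWord n r) = ⟨l, hl, hr⟩ := by
  induction l with
  | nil => rfl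
  | cons a l ih =>
    rw [List.map_cons, List.prod_cons, Equiv.Perm.mul_apply,
      ih hl.tail (by simp at hr; omega)]
    have h1 : ¬ (l.head? = some a) := by
      intro h
      rw [List.isChain_cons] at hl
      exact hl.1 a h rfl
    have h2 : l.length < r := by simpa using hr
    change flipFun a _ = _
    simp [flipFun, h1, h2]
    rfl

theorem prod_flip_ne_one (l : List (Fin n)) (hl : l.IsChain (· ≠ ·)) (hr : l.length ≤ r)
    (h0 : l ≠ []) : (l.map flip).prod ≠ (1 : Equiv.Perm (ReducedWord n r)) := by
  intro h
  have := prod_flip_apply_nil l hl hr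
  rw [h] at this
  exact h0 (Subtype.mk.inj this).symm

theorem flip_injective (hr : 2 ≤ r) :
    Function.Injective (flip : Fin n → Equiv.Perm (ReducedWord n r)) := by
  intro i j h
  by_contra hij
  refine prod_flip_ne_one (r := r) [i, j] (by simpa using hij) (by simpa using hr) (by simp) ?_
  simp [h, flip_mul_flip]

/-- A walk in the Cayley graph of the flips that never backtracks is not closed, if short. -/
theorem ne_of_forall_eq_mul_flip {L : ℕ} (g : ℕ → Equiv.Perm (ReducedWord n r)) (col : ℕ → Fin n)
    (hg : ∀ m < L, g (m + 1) = g m * flip (col m))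
    (hcol : ∀ m, m + 1 < L → col m ≠ col (m + 1)) (h0 : 0 < L) (hL : L ≤ r) : g L ≠ g 0 := by
  have key : ∀ m ≤ L, g m = g 0 * (((List.range m).map col).map flip).prod := by
    intro m
    induction m with
    | zero => simp
    | succ m ih =>
      intro hm
      rw [hg m (by omega), ih (by omega), List.range_succ]
      simp [mul_assoc]
  intro h
  rw [key L le_rfl] at h
  refine prod_flip_ne_one (r := r) ((List.range L).map col) ?_ (by simpa using hL)
    (by simp; omega) (by simpa using h)
  rw [List.isChain_iff_getElem]
  intro i hi
  simp only [List.getElem_map, List.getElem_range]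
  simp at hi
  exact hcol i (by omega)

/-- A set of permutations containing `1` and closed under right multiplication by products of two
flips is large. -/
theorem lt_ncard_of_closed {n r : ℕ} (hn : 2 ≤ n) {A : Set (Equiv.Perm (ReducedWord n r))}
    (h1 : 1 ∈ A) (hA : ∀ g ∈ A, ∀ i j, g * flip i * flip j ∈ A) : r / 2 < A.ncard := by
  let i : Fin n := ⟨0, by omega⟩
  let j : Fin n := ⟨1, by omega⟩
  have hij : i ≠ j := by simp [i, j]
  let word : ℕ → List (Fin n) := fun m => Nat.rec [] (fun _ l => i :: j :: l) m
  have hs : ∀ m, word (m + 1) = i :: j :: word m := fun m => rfl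
  have hlen : ∀ m, (word m).length = 2 * m := by
    intro m
    induction m with
    | zero => rfl
    | succ m ih => rw [hs]; simp [ih]; ring
  have hchain : ∀ m, (word m).IsChain (· ≠ ·) := by
    intro m
    induction m with
    | zero => simp [word]
    | succ m ih =>
      rw [hs]
      cases m with
      | zero => simpa [word] using hij
      | succ m =>
        rw [hs] at ih ⊢
        simp only [List.isChain_cons_cons] at ih ⊢
        exact ⟨hij, hij.symm, ih⟩
  have hprod : ∀ m, ((word m).map flip).prod = (flip i * flip j : Equiv.Perm
      (ReducedWord n r)) ^ m := by
    intro m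
    induction m with
    | zero => rfl
    | succ m ih => rw [hs]; simp [ih, pow_succ', mul_assoc]
  have hmem : ∀ m, (flip i * flip j : Equiv.Perm (ReducedWord n r)) ^ m ∈ A := by
    intro m
    induction m with
    | zero => simpa using h1
    | succ m ih => rw [pow_succ, ← mul_assoc]; exact hA _ ih i j
  -- The words `(ij)^m` with `m ≤ r / 2` have length at most `r` and are read off from the image of
  -- the empty word.
  have hinj : Set.InjOn (fun m => (flip i * flip j : Equiv.Perm (ReducedWord n r)) ^ m)
      (Finset.range (r / 2 + 1) : Set ℕ) := by
    intro a ha b hb hab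
    simp only [Finset.coe_range, Set.mem_Iio] at ha hb
    have ha' := prod_flip_apply_nil (r := r) (word a) (hchain a) (by rw [hlen]; omega)
    have hb' := prod_flip_apply_nil (r := r) (word b) (hchain b) (by rw [hlen]; omega)
    simp only at hab
    rw [hprod, hab, ← hprod, hb'] at ha'
    have := congrArg List.length (Subtype.mk.inj ha')
    rw [hlen, hlen] at this
    omega
  have h2 := hinj.ncard_image
  rw [Set.ncard_coe_finset, Finset.card_range] at h2
  have h3 : (fun m => (flip i * flip j : Equiv.Perm (ReducedWord n r)) ^ m) ''
      (Finset.range (r / 2 + 1) : Set ℕ) ⊆ A := by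
    rintro _ ⟨m, -, rfl⟩
    exact hmem m
  have := Set.ncard_le_ncard h3 (Set.toFinite _)
  omega

end ReducedWord

/-! ### The gadget graph for arbitrary centres and units. -/

/-- Vertices of the graph consisting of centres `C`, paths on `z + 1` vertices indexed by `U`
and `b` leaves for each centre. -/
inductive GadgetVert (C U : Type) (z b : ℕ) : Type
  | core (c : C) : GadgetVert C U z b
  | unit (a : U) (i : Fin (z + 1)) : GadgetVert C U z b
  | leaf (c : C) (l : Fin b) : GadgetVert C U z b

namespace GadgetVert

variable {C U : Type} {z b : ℕ}

/-- Parent-to-child relation. -/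
inductive Rel (att : U → C → Prop) : GadgetVert C U z b → GadgetVert C U z b → Prop
  | base (a : U) (c : C) (h : att a c) : Rel att (core c) (unit a 0)
  | step (a : U) (i : Fin z) : Rel att (unit a i.castSucc) (unit a i.succ)
  | leaf (c : C) (l : Fin b) : Rel att (core c) (leaf c l)

def equivSum : GadgetVert C U z b ≃ C ⊕ (U × Fin (z + 1)) ⊕ (C × Fin b) where
  toFun x := match x with
    | core c => Sum.inl c
    | unit a i => Sum.inr (Sum.inl (a, i))
    | leaf c l => Sum.inr (Sum.inr (c, l))
  invFun x := match x with
    | Sum.inl c => core c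
    | Sum.inr (Sum.inl (a, i)) => unit a i
    | Sum.inr (Sum.inr (c, l)) => leaf c l
  left_inv x := by cases x <;> rfl
  right_inv x := by rcases x with _ | _ | _ <;> rfl

instance [Finite C] [Finite U] : Finite (GadgetVert C U z b) :=
  Finite.of_equiv _ equivSum.symm

theorem natCard [Finite C] [Finite U] : Nat.card (GadgetVert C U z b) =
    Nat.card C + (Nat.card U * (z + 1) + Nat.card C * b) := by
  rw [Nat.card_congr equivSum, Nat.card_sum, Nat.card_sum, Nat.card_prod, Nat.card_prod]
  simp

theorem Rel.ne {att : U → C → Prop} {x y : GadgetVert C U z b} (h : Rel att x y) : x ≠ y := by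
  cases h with
  | base => simp
  | step a i =>
    intro h
    have := congrArg Fin.val (unit.inj h).2
    simp at this
  | leaf => simp

/-- The first vertex of each unit `a` is joined to the centres `c` with `att a c`. -/
def graph (z b : ℕ) (att : U → C → Prop) : SimpleGraph (GadgetVert C U z b) where
  Adj x y := Rel att x y ∨ Rel att y x
  symm := ⟨fun _ _ h => h.symm⟩
  loopless := ⟨fun _ h => h.elim (fun h => h.ne rfl) fun h => h.ne rfl⟩

variable {att : U → C → Prop}

theorem adj_leaf {c : C} {l : Fin b} {x : GadgetVert C U z b}
    (h : (graph z b att).Adj (leaf c l) x) : x = core c := by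
  rcases h with h | h <;> cases h
  rfl

theorem adj_core {c : C} {x : GadgetVert C U z b} (h : (graph z b att).Adj (core c) x) :
    (∃ l, x = leaf c l) ∨ ∃ a, att a c ∧ x = unit a 0 := by
  rcases h with h | h <;> cases h
  · exact Or.inr ⟨_, ‹_›, rfl⟩
  · exact Or.inl ⟨_, rfl⟩

theorem adj_unit {a : U} {i : Fin (z + 1)} {x : GadgetVert C U z b}
    (h : (graph z b att).Adj (unit a i) x) :
    (i = 0 ∧ ∃ c, att a c ∧ x = core c) ∨
    ∃ j : Fin (z + 1), x = unit a j ∧ (j.1 = i.1 + 1 ∨ i.1 = j.1 + 1) := by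
  rcases h with h | h
  · cases h
    exact Or.inr ⟨_, rfl, Or.inl (by simp)⟩
  · cases h
    · exact Or.inl ⟨rfl, _, ‹_›, rfl⟩
    · exact Or.inr ⟨_, rfl, Or.inr (by simp)⟩

theorem edgeSet_graph : (graph z b att).edgeSet = Set.range
    (fun e : (U × Fin z) ⊕ (C × Fin b) ⊕ {p : U × C // att p.1 p.2} => match e with
      | Sum.inl (a, i) => s(unit a i.castSucc, unit a i.succ)
      | Sum.inr (Sum.inl (c, l)) => s(core c, leaf c l)
      | Sum.inr (Sum.inr p) => s(core p.1.2, unit p.1.1 0)) := by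
  have key : ∀ x y : GadgetVert C U z b, Rel att x y → s(x, y) ∈ Set.range
      (fun e : (U × Fin z) ⊕ (C × Fin b) ⊕ {p : U × C // att p.1 p.2} => match e with
        | Sum.inl (a, i) => s(unit a i.castSucc, unit a i.succ)
        | Sum.inr (Sum.inl (c, l)) => s(core c, leaf c l)
        | Sum.inr (Sum.inr p) => s(core p.1.2, unit p.1.1 0)) := by
    intro x y h
    cases h with
    | base a c h => exact ⟨Sum.inr (Sum.inr ⟨(a, c), h⟩), rfl⟩
    | step a i => exact ⟨Sum.inl (a, i), rfl⟩
    | leaf c l => exact ⟨Sum.inr (Sum.inl (c, l)), rfl⟩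
  ext e
  constructor
  · induction e with | _ x y
    rintro (h | h)
    · exact key _ _ h
    · rw [Sym2.eq_swap]
      exact key _ _ h
  · rintro ⟨(⟨a, i⟩ | ⟨c, l⟩ | ⟨p, hp⟩), rfl⟩
    · exact Or.inl (Rel.step a i)
    · exact Or.inl (Rel.leaf c l)
    · exact Or.inl (Rel.base _ _ hp)

theorem edge_injective : Function.Injective
    (fun e : (U × Fin z) ⊕ (C × Fin b) ⊕ {p : U × C // att p.1 p.2} => match e with
      | Sum.inl (a, i) => (s(unit a i.castSucc, unit a i.succ) : Sym2 (GadgetVert C U z b))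
      | Sum.inr (Sum.inl (c, l)) => s(core c, leaf c l)
      | Sum.inr (Sum.inr p) => s(core p.1.2, unit p.1.1 0)) := by
  rintro (⟨a, i⟩ | ⟨c, l⟩ | ⟨⟨a, c⟩, hp⟩) (⟨a', i'⟩ | ⟨c', l'⟩ | ⟨⟨a', c'⟩, hp'⟩) h <;>
    simp [Fin.ext_iff] at h ⊢
  · grind
  · exact h
  · exact h.symm

theorem ncard_edgeSet_graph [Finite C] [Finite U] : (graph z b att).edgeSet.ncard =
    Nat.card U * z + (Nat.card C * b + Nat.card {p : U × C // att p.1 p.2}) := by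
  rw [edgeSet_graph, ← Set.image_univ, Set.ncard_image_of_injective _ edge_injective,
    Set.ncard_univ, Nat.card_sum, Nat.card_sum, Nat.card_prod, Nat.card_prod]
  simp

/-! ### Girth -/

/-- If every vertex of `S` has two neighbours in `S`, then `S` contains no leaves and only the first
vertices of units. -/
theorem eq_zero_of_two_neighbors {S : Set (GadgetVert C U z b)}
    (hS : ∀ x ∈ S, ∃ y ∈ S, ∃ y' ∈ S, y ≠ y' ∧ (graph z b att).Adj x y ∧
      (graph z b att).Adj x y') :
    (∀ c l, leaf c l ∉ S) ∧ ∀ a i, unit a i ∈ S → i = 0 := by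
  constructor
  · intro c l h
    obtain ⟨y, -, y', -, hne, h1, h2⟩ := hS _ h
    exact hne ((adj_leaf h1).trans (adj_leaf h2).symm)
  · intro a
    -- Induction on the distance to the tip: of two distinct neighbours of a non-first vertex, one
    -- is nearer to the tip, and it is already excluded.
    have key : ∀ n, ∀ i : Fin (z + 1), z - i.1 = n → unit a i ∈ S → i = 0 := by
      intro n
      induction n with
      | zero =>
        intro i hi h
        by_contra hne
        obtain ⟨y, -, y', -, hyy, h1, h2⟩ := hS _ h
        rcases adj_unit h1 with ⟨h0, -⟩ | ⟨j, rfl, hj⟩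
        · exact hne h0
        rcases adj_unit h2 with ⟨h0, -⟩ | ⟨j', rfl, hj'⟩
        · exact hne h0
        have := j.2; have := j'.2
        exact hyy (congrArg _ (Fin.ext (by omega)))
      | succ n ih =>
        intro i hi h
        by_contra hne
        obtain ⟨y, hy, y', hy', hyy, h1, h2⟩ := hS _ h
        rcases adj_unit h1 with ⟨h0, -⟩ | ⟨j, rfl, hj⟩
        · exact hne h0
        rcases adj_unit h2 with ⟨h0, -⟩ | ⟨j', rfl, hj'⟩
        · exact hne h0
        have hjj : j.1 ≠ j'.1 := fun h => hyy (congrArg _ (Fin.ext h))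
        rcases hj with hj | hj
        · have := ih j (by omega) hy
          have := congrArg Fin.val this
          rw [Fin.val_zero] at this
          omega
        · have := ih j' (by omega) hy'
          have := congrArg Fin.val this
          rw [Fin.val_zero] at this
          omega
    exact fun i => key _ i rfl

end GadgetVert

/-! ### Girth of the gadget over the group generated by flips. -/

namespace GadgetVert

variable {P : Type} {n r z b : ℕ}

/-- Units of the form `Sum.inl p` hang at the centre `ρ p`, the units of the form `Sum.inr g` are
shared by the centres `g * flip i`. -/
def attach (ρ : P → Equiv.Perm (ReducedWord n r)) :
    P ⊕ Equiv.Perm (ReducedWord n r) → Equiv.Perm (ReducedWord n r) → Prop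
  | Sum.inl p, c => c = ρ p
  | Sum.inr g, c => ∃ i, c = g * ReducedWord.flip i

/-- The group element underlying a vertex (junk at private units and leaves). -/
def group : GadgetVert (Equiv.Perm (ReducedWord n r)) (P ⊕ Equiv.Perm (ReducedWord n r)) z b →
    Equiv.Perm (ReducedWord n r)
  | core c => c
  | unit (Sum.inr g) _ => g
  | unit (Sum.inl _) _ => 1
  | leaf c _ => c

def isCore : GadgetVert (Equiv.Perm (ReducedWord n r)) (P ⊕ Equiv.Perm (ReducedWord n r)) z b →
    Bool
  | core _ => true
  | _ => false

/-- A cycle avoids leaves, private units and non-first vertices of shared units, so it lives in the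
bipartite graph joining group elements that differ by a flip. Reading off the flips gives a reduced
word with trivial product, so its length exceeds `r`. -/
theorem lt_length_of_isCycle (ρ : P → Equiv.Perm (ReducedWord n r))
    {u : GadgetVert (Equiv.Perm (ReducedWord n r)) (P ⊕ Equiv.Perm (ReducedWord n r)) z b}
    (w : (graph z b (attach ρ)).Walk u u) (hw : w.IsCycle) : r < w.length := by
  by_contra! hlen
  set S : Set (GadgetVert (Equiv.Perm (ReducedWord n r)) (P ⊕ Equiv.Perm (ReducedWord n r)) z b) :=
    {x | x ∈ w.support} with hSdef
  have hS : ∀ x ∈ S, ∃ y ∈ S, ∃ y' ∈ S, y ≠ y' ∧ (graph z b (attach ρ)).Adj x y ∧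
      (graph z b (attach ρ)).Adj x y' := by
    intro x hx
    have h2 := hw.ncard_neighborSet_toSubgraph_eq_two hx
    obtain ⟨y, y', hne, hyy⟩ := Set.ncard_eq_two.1 h2
    have hy : y ∈ w.toSubgraph.neighborSet x := by rw [hyy]; simp
    have hy' : y' ∈ w.toSubgraph.neighborSet x := by rw [hyy]; simp
    refine ⟨y, ?_, y', ?_, hne, hy.adj_sub, hy'.adj_sub⟩
    · exact (SimpleGraph.Walk.mem_verts_toSubgraph w).1 hy.snd_mem
    · exact (SimpleGraph.Walk.mem_verts_toSubgraph w).1 hy'.snd_mem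
  obtain ⟨hleaf, hunit⟩ := eq_zero_of_two_neighbors hS
  have hpriv : ∀ p i, unit (Sum.inl p) i ∉ S := by
    intro p i h
    have hi := hunit _ _ h
    subst hi
    obtain ⟨y, hy, y', hy', hyy, h1, h2⟩ := hS _ h
    have aux : ∀ y ∈ S, (graph z b (attach ρ)).Adj (unit (Sum.inl p) 0) y → y = core (ρ p) := by
      intro y hy h1
      rcases adj_unit h1 with ⟨-, c, hc, rfl⟩ | ⟨j, rfl, hj⟩
      · rw [show c = ρ p from hc]
      · have := congrArg Fin.val (hunit _ _ hy)
        simp only [Fin.val_zero] at this hj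
        omega
    exact hyy ((aux y hy h1).trans (aux y' hy' h2).symm)
  have hstep : ∀ x ∈ S, ∀ y ∈ S, (graph z b (attach ρ)).Adj x y →
      isCore y = !isCore x ∧ ∃ i, group y = group x * ReducedWord.flip i := by
    intro x hx y hy hxy
    cases x with
    | leaf c l => exact (hleaf c l hx).elim
    | core c =>
      rcases adj_core hxy with ⟨l, rfl⟩ | ⟨a, ha, rfl⟩
      · exact (hleaf c l hy).elim
      · cases a with
        | inl p => exact (hpriv p 0 hy).elim
        | inr g =>
          obtain ⟨i, hi⟩ := ha
          refine ⟨rfl, i, ?_⟩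
          simp only [group]
          rw [hi, mul_assoc, ReducedWord.flip_mul_flip, mul_one]
    | unit a i =>
      have hi := hunit _ _ hx
      subst hi
      rcases adj_unit hxy with ⟨-, c, hc, rfl⟩ | ⟨j, rfl, hj⟩
      · cases a with
        | inl p => exact (hpriv p 0 hx).elim
        | inr g => exact ⟨rfl, hc⟩
      · have := congrArg Fin.val (hunit _ _ hy)
        simp only [Fin.val_zero] at this hj
        omega
  have hinj : ∀ x ∈ S, ∀ y ∈ S, isCore x = isCore y → group x = group y → x = y := by
    intro x hx y hy h1 h2
    cases x with
    | leaf c l => exact (hleaf c l hx).elim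
    | core c =>
      cases y with
      | leaf c l => exact (hleaf c l hy).elim
      | core c' => exact congrArg core h2
      | unit a i => simp [isCore] at h1
    | unit a i =>
      have hi := hunit _ _ hx
      cases y with
      | leaf c l => exact (hleaf c l hy).elim
      | core c' => simp [isCore] at h1
      | unit a' i' =>
        have hi' := hunit _ _ hy
        subst hi hi'
        cases a with
        | inl p => exact (hpriv p 0 hx).elim
        | inr g =>
          cases a' with
          | inl p => exact (hpriv p 0 hy).elim
          | inr g' => rw [show g = g' from h2]
  have hmem : ∀ m, w.getVert m ∈ S := fun m => w.getVert_mem_support m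
  have hadj : ∀ m < w.length, (graph z b (attach ρ)).Adj (w.getVert m) (w.getVert (m + 1)) :=
    fun m hm => w.adj_getVert_succ hm
  have h3 := hw.three_le_length
  have hcol : ∀ m : ℕ, ∃ i : Fin n, m < w.length →
      group (w.getVert (m + 1)) = group (w.getVert m) * ReducedWord.flip i := by
    intro m
    by_cases hm : m < w.length
    · obtain ⟨-, i, hi⟩ := hstep _ (hmem m) _ (hmem (m + 1)) (hadj m hm)
      exact ⟨i, fun _ => hi⟩
    · obtain ⟨-, i, hi⟩ := hstep _ (hmem 0) _ (hmem 1) (hadj 0 (by omega))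
      exact ⟨i, fun h => (hm h).elim⟩
  choose col hcol using hcol
  refine ReducedWord.ne_of_forall_eq_mul_flip (L := w.length)
    (fun m => group (w.getVert m)) col hcol ?_ (by omega) hlen ?_
  -- Equal consecutive letters would lead back to the same group element on the same side, that is,
  -- to the same vertex two steps later.
  · intro m hm heq
    have e1 : group (w.getVert (m + 2)) = group (w.getVert m) := by
      rw [hcol (m + 1) hm, hcol m (by omega), ← heq, mul_assoc, ReducedWord.flip_mul_flip, mul_one]
    have e2 : isCore (w.getVert (m + 2)) = isCore (w.getVert m) := by
      rw [(hstep _ (hmem (m + 1)) _ (hmem (m + 2)) (hadj (m + 1) hm)).1,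
        (hstep _ (hmem m) _ (hmem (m + 1)) (hadj m (by omega))).1, Bool.not_not]
    have e3 := hinj _ (hmem _) _ (hmem _) e2 e1
    -- The start vertex occurs at both ends of the closed walk, so it needs the other injectivity
    -- statement.
    rcases Nat.eq_zero_or_pos m with rfl | hm0
    · have := hw.getVert_injOn' (by simp; omega) (by simp) e3
      omega
    · have := hw.getVert_injOn (by simp; omega) (by simp; omega) e3
      omega
  · simp

end GadgetVert

/-! ### Tips, leaves and components of subgraphs of the gadget. -/

namespace SimpleGraph

theorem Walk.le_add_length_of_lipschitz {V : Type*} {F : SimpleGraph V} {f : V → ℕ}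
    (hf : ∀ x y, F.Adj x y → f y ≤ f x + 1) {u v : V} (p : F.Walk u v) :
    f v ≤ f u + p.length := by
  induction p with
  | nil => simp
  | cons h p ih =>
    have := hf _ _ h
    rw [Walk.length_cons]
    omega

end SimpleGraph

namespace GadgetVert

open SimpleGraph

variable {C U : Type} {z b : ℕ} {att : U → C → Prop} {F : SimpleGraph (GadgetVert C U z b)}

theorem le_dist_tips (hF : F ≤ graph z b att) {a a' : U} (ha : a ≠ a')
    (hr : F.Reachable (unit a (Fin.last z)) (unit a' (Fin.last z))) :
    2 * (z + 1) ≤ F.dist (unit a (Fin.last z)) (unit a' (Fin.last z)) := by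
  classical
  obtain ⟨p, hp⟩ := hr.exists_walk_length_eq_dist
  -- A potential changing by at most one along edges: it climbs from `0` at the first tip to `z + 1`
  -- at the centres and on to `2 * (z + 1)` at the second tip.
  let f : GadgetVert C U z b → ℕ := fun x => match x with
    | core _ => z + 1
    | leaf _ _ => z + 1
    | unit a₁ i => if a₁ = a then z - i.1 else if a₁ = a' then z + 2 + i.1 else z + 1
  have hf : ∀ x y, F.Adj x y → f y ≤ f x + 1 := by
    intro x y hxy
    replace hxy := hF hxy
    cases x with
    | leaf c l => rw [adj_leaf hxy]; simp [f]
    | core c =>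
      rcases adj_core hxy with ⟨l, rfl⟩ | ⟨a₁, -, rfl⟩
      · simp [f]
      · simp only [f, Fin.val_zero]
        split_ifs <;> omega
    | unit a₁ i =>
      rcases adj_unit hxy with ⟨rfl, c, -, rfl⟩ | ⟨j, rfl, hj⟩
      · simp only [f, Fin.val_zero]
        split_ifs <;> omega
      · simp only [f]
        have := i.2
        have := j.2
        split_ifs <;> omega
  have := p.le_add_length_of_lipschitz hf
  rw [← hp]
  simp only [f, Fin.val_last, if_true, if_neg ha.symm] at this
  omega

/-- A unit can be left only through its first vertex towards a centre, so a walk from the tip to the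
outside traverses the whole unit. -/
theorem unit_mem_supp (hF : F ≤ graph z b att) {K : F.ConnectedComponent} {a : U}
    (ha : unit a (Fin.last z) ∈ K.supp) {y : GadgetVert C U z b} (hy : y ∈ K.supp)
    (hya : ∀ i, y ≠ unit a i) :
    (∀ i, unit a i ∈ K.supp) ∧ ∃ c, core c ∈ K.supp := by
  classical
  obtain ⟨p⟩ := K.reachable_of_mem_supp ha hy
  constructor
  · intro i
    -- The walk leaves the part of the unit from `i` to the tip, which is possible only at `i`.
    obtain ⟨d, hd, ⟨j, hij, hj⟩, h2⟩ := p.exists_boundary_dart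
      {x | ∃ j : Fin (z + 1), i ≤ j ∧ x = unit a j} ⟨Fin.last z, Fin.le_last i, rfl⟩
      (fun ⟨j, _, h⟩ => hya j h)
    have hK : unit a j ∈ K.supp := by
      rw [← hj]
      have := (p.takeUntil _ (p.dart_fst_mem_support_of_mem_darts hd)).reachable
      exact (ConnectedComponent.sound this.symm).trans ha
    suffices h : i = j by rw [h]; exact hK
    have hadj := hF d.adj
    rw [hj] at hadj
    rcases adj_unit hadj with ⟨rfl, -⟩ | ⟨j', hj', h | h⟩
    · exact le_antisymm hij (Fin.zero_le _)
    · exact (h2 ⟨j', by rw [Fin.le_def] at hij ⊢; omega, hj'⟩).elim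
    · by_contra hne
      refine h2 ⟨j', ?_, hj'⟩
      have := lt_of_le_of_ne hij hne
      rw [Fin.lt_def] at this
      rw [Fin.le_def]
      omega
  · obtain ⟨d, hd, ⟨j, hj⟩, h2⟩ := p.exists_boundary_dart
      {x | ∃ j : Fin (z + 1), x = unit a j} ⟨Fin.last z, rfl⟩ (fun ⟨j, h⟩ => hya j h)
    have hadj := hF d.adj
    rw [hj] at hadj
    rcases adj_unit hadj with ⟨-, c, -, hc⟩ | ⟨j', hj', -⟩
    · refine ⟨c, ?_⟩
      rw [← hc]
      have := (p.takeUntil _ (p.dart_snd_mem_support_of_mem_darts hd)).reachable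
      exact (ConnectedComponent.sound this.symm).trans ha
    · exact (h2 ⟨j', hj'⟩).elim

open Classical in
/-- A small component with several tips comes with many leaves that are components on their own. -/
theorem card_tips_le [Fintype C] [Fintype U] (hF : F ≤ graph z b att) (K : F.ConnectedComponent)
    (hK : 2 * (z + 1) ≤ K.toSimpleGraph.diam →
      K.toSimpleGraph.edgeSet.ncard < 2 * z + 2 + b) :
    (Finset.univ.filter fun a : U => F.connectedComponentMk (unit a (Fin.last z)) = K).card ≤
      (if ∃ a : U, F.connectedComponentMk (unit a (Fin.last z)) = K then 1 else 0) +
      ((Finset.univ.filter fun p : C × Fin b => ¬ F.Adj (core p.1) (leaf p.1 p.2)).filter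
        fun p => F.connectedComponentMk (core p.1) = K).card := by
  set T := Finset.univ.filter fun a : U => F.connectedComponentMk (unit a (Fin.last z)) = K
    with hT
  rcases Nat.lt_or_ge T.card 2 with h | h
  · rcases Nat.eq_zero_or_pos T.card with h0 | h0
    · omega
    · obtain ⟨a, ha⟩ := Finset.card_pos.1 h0
      rw [if_pos ⟨a, by simpa [hT] using ha⟩]
      omega
  obtain ⟨a₁, h₁, a₂, h₂, hne⟩ := Finset.one_lt_card.1 h
  have hmemT : ∀ a, a ∈ T ↔ unit a (Fin.last z) ∈ K.supp := by simp [hT]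
  have hfull : ∀ a ∈ T, (∀ i, unit a i ∈ K.supp) ∧ ∃ c, core c ∈ K.supp := by
    intro a ha
    obtain ⟨a', ha', hne'⟩ : ∃ a' ∈ T, a' ≠ a := by
      by_cases h : a₁ = a
      · exact ⟨a₂, h₂, fun h' => hne (h.trans h'.symm)⟩
      · exact ⟨a₁, h₁, h⟩
    refine unit_mem_supp hF ((hmemT a).1 ha) ((hmemT a').1 ha') fun i hi => hne' ?_
    exact (unit.inj hi).1
  rw [if_pos ⟨a₁, (hmemT a₁).1 h₁⟩]
  have hsmall := hK <| (le_dist_tips hF hne <|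
    K.reachable_of_mem_supp ((hmemT a₁).1 h₁) ((hmemT a₂).1 h₂)).trans
    (K.le_diam_toSimpleGraph ((hmemT a₁).1 h₁) ((hmemT a₂).1 h₂))
  have hsupp := K.ncard_supp_le
  set N := Finset.univ.filter fun c : C => F.connectedComponentMk (core c) = K with hN
  have hN1 : 1 ≤ N.card := by
    obtain ⟨c, hc⟩ := (hfull a₁ h₁).2
    exact Finset.card_pos.2 ⟨c, by simpa [hN] using hc⟩
  have hsplit := Finset.card_filter_add_card_filter_not (s := N ×ˢ (Finset.univ : Finset (Fin b)))
    (fun p => F.Adj (core p.1) (leaf p.1 p.2))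
  rw [Finset.card_product, Finset.card_univ, Fintype.card_fin] at hsplit
  have hI : ((N ×ˢ (Finset.univ : Finset (Fin b))).filter
      fun p => ¬ F.Adj (core p.1) (leaf p.1 p.2)) =
      ((Finset.univ.filter fun p : C × Fin b => ¬ F.Adj (core p.1) (leaf p.1 p.2)).filter
        fun p => F.connectedComponentMk (core p.1) = K) := by
    ext p
    simp [hN, and_comm]
  rw [hI] at hsplit
  set I := ((Finset.univ.filter fun p : C × Fin b => ¬ F.Adj (core p.1) (leaf p.1 p.2)).filter
        fun p => F.connectedComponentMk (core p.1) = K)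
  set J := (N ×ˢ (Finset.univ : Finset (Fin b))).filter
      fun p => F.Adj (core p.1) (leaf p.1 p.2) with hJ
  have hcount : N.card + (T.card * (z + 1) + J.card) ≤ K.supp.ncard := by
    have hsub : ((N.disjSum ((T ×ˢ (Finset.univ : Finset (Fin (z + 1)))).disjSum J)).map
        (equivSum (C := C) (U := U) (z := z) (b := b)).symm.toEmbedding : Set _) ⊆ K.supp := by
      intro x hx
      simp only [Finset.coe_map, Set.mem_image, Finset.mem_coe, Finset.mem_disjSum] at hx
      obtain ⟨y, (⟨c, hc, rfl⟩ | ⟨y, ⟨p, hp, rfl⟩ | ⟨p, hp, rfl⟩, rfl⟩), rfl⟩ := hx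
      · exact (Finset.mem_filter.1 hc).2
      · exact (hfull p.1 (Finset.mem_product.1 hp).1).1 p.2
      · rw [hJ, Finset.mem_filter, Finset.mem_product] at hp
        exact (ConnectedComponent.sound hp.2.reachable.symm).trans (Finset.mem_filter.1 hp.1.1).2
    have := Set.ncard_le_ncard hsub (Set.toFinite _)
    rw [Set.ncard_coe_finset, Finset.card_map, Finset.card_disjSum, Finset.card_disjSum,
      Finset.card_product, Finset.card_univ, Fintype.card_fin] at this
    exact this
  -- With `2 + t` tips, the vertex count gives `t * (z + 1) + N.card + J.card ≤ b`. So at least `t +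
  -- 1` of the `N.card * b` leaves of these centres are not attached.
  obtain ⟨t, ht⟩ := Nat.exists_eq_add_of_le h
  rw [ht] at hcount ⊢
  have h3 : t ≤ t * (z + 1) := Nat.le_mul_of_pos_right _ (by omega)
  have h4 : b ≤ N.card * b := Nat.le_mul_of_pos_left _ (by omega)
  have h5 : (2 + t) * (z + 1) = 2 * z + 2 + t * (z + 1) := by ring
  omega

open Classical in
/-- If a subgraph of the gadget graph has enough edges, then some component is large and has large
diameter. -/
theorem exists_large_component [Finite C] [Finite U] (hF : F ≤ graph z b att)
    (hg : ∀ (u : GadgetVert C U z b) (w : (graph z b att).Walk u u), w.IsCycle →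
      4 * z + b + 4 ≤ w.length)
    (he : Nat.card (GadgetVert C U z b) + 1 ≤ F.edgeSet.ncard + Nat.card U) :
    ∃ K : F.ConnectedComponent, 2 * z + 2 + b ≤ K.toSimpleGraph.edgeSet.ncard ∧
      2 * (z + 1) ≤ K.toSimpleGraph.diam := by
  have := Fintype.ofFinite C
  have := Fintype.ofFinite U
  have hgF : ∀ (u : GadgetVert C U z b) (w : F.Walk u u), w.IsCycle →
      4 * z + b + 4 ≤ w.length := by
    intro u w hw
    simpa using hg u (w.mapLe hF) (hw.mapLe hF)
  by_cases hac : F.IsAcyclic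
  swap
  · simp only [IsAcyclic, not_forall, not_not] at hac
    obtain ⟨u, w, hw⟩ := hac
    refine ⟨F.connectedComponentMk u, ?_, ?_⟩
    · have h1 := hw.length_le_ncard_supp
      have h2 := (F.connectedComponentMk u).ncard_supp_le
      have h3 := hgF u w hw
      omega
    · obtain ⟨v, hv, hd⟩ := hw.exists_le_dist (n := 2 * (z + 1)) (by omega)
        (fun u p hp => by have := hgF u p hp; omega)
      exact hd.trans (ConnectedComponent.le_diam_toSimpleGraph _ rfl
        (ConnectedComponent.sound hv.symm))
  by_contra! hno
  have hcomp := hac.ncard_edgeSet_add_card_component_le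
  have := Fintype.ofFinite F.ConnectedComponent
  rw [Nat.card_eq_fintype_card (α := F.ConnectedComponent)] at hcomp
  rw [Nat.card_eq_fintype_card (α := U)] at he
  -- Components with a tip and isolated leaves are disjoint families of components; by
  -- `card_tips_le` together they number at least as many as the units.
  suffices h : Fintype.card U ≤ Fintype.card F.ConnectedComponent by omega
  set I := Finset.univ.filter fun p : C × Fin b => ¬ F.Adj (core p.1) (leaf p.1 p.2) with hI
  have h1 := Finset.card_eq_sum_card_fiberwise (s := (Finset.univ : Finset U))
    (t := (Finset.univ : Finset F.ConnectedComponent))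
    (f := fun a => F.connectedComponentMk (unit a (Fin.last z)))
    (fun _ _ => Finset.mem_coe.2 (Finset.mem_univ _))
  have h2 := Finset.card_eq_sum_card_fiberwise (s := I)
    (t := (Finset.univ : Finset F.ConnectedComponent))
    (f := fun p => F.connectedComponentMk (core p.1))
    (fun _ _ => Finset.mem_coe.2 (Finset.mem_univ _))
  have h3 := Finset.sum_le_sum fun K (_ : K ∈ (Finset.univ : Finset F.ConnectedComponent)) =>
    card_tips_le hF K fun h => by
      by_contra! h'
      exact absurd h (not_le.2 (hno K h'))
  rw [Finset.sum_add_distrib, ← h1, ← h2, ← Finset.card_filter, Finset.card_univ] at h3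
  refine h3.trans ?_
  have hiso : ∀ p ∈ I, ∀ y, F.Reachable (leaf p.1 p.2) y → y = leaf p.1 p.2 := by
    rintro p hp y ⟨w⟩
    cases w with
    | nil => rfl
    | cons h w =>
      have := adj_leaf (hF h)
      subst this
      exact ((Finset.mem_filter.1 hp).2 h.symm).elim
  have hinj : Set.InjOn (fun p : C × Fin b => F.connectedComponentMk (leaf p.1 p.2)) I := by
    intro p hp q hq hpq
    have := hiso p hp _ (ConnectedComponent.exact hpq)
    have := leaf.inj this
    exact Prod.ext this.1.symm (eq_of_heq (by simp [this.2]))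
  rw [← Finset.card_image_of_injOn hinj, ← Finset.card_union_of_disjoint, ← Finset.card_univ]
  · exact Finset.card_le_card (Finset.subset_univ _)
  · rw [Finset.disjoint_left]
    intro K hK hK'
    obtain ⟨p, hp, rfl⟩ := Finset.mem_image.1 hK'
    obtain ⟨a, ha⟩ := (Finset.mem_filter.1 hK).2
    have := hiso p hp _ (ConnectedComponent.exact ha.symm)
    cases this

end GadgetVert

/-! ### Edge density inside vertex sets of the gadget. -/

namespace GadgetVert

theorem sum_consecutive_add_le {z : ℕ} (χ : Fin (z + 1) → ℕ) (hχ : ∀ i, χ i = 0 ∨ χ i = 1) :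
    ∑ i : Fin z, χ i.castSucc * χ i.succ + χ 0 ≤ ∑ i, χ i := by
  rw [Fin.sum_univ_succ (f := χ), add_comm]
  refine Nat.add_le_add_left (Finset.sum_le_sum fun i _ => ?_) _
  rcases hχ i.castSucc with h | h <;> simp [h]

/-- Consecutive pairs in a nonempty set of path vertices are fewer than the vertices. -/
theorem sum_consecutive_lt {z : ℕ} (χ : Fin (z + 1) → ℕ) (hχ : ∀ i, χ i = 0 ∨ χ i = 1)
    (h : ∃ i, χ i = 1) :
    ∑ i : Fin z, χ i.castSucc * χ i.succ + 1 ≤ ∑ i, χ i := by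
  induction z with
  | zero =>
    obtain ⟨i, hi⟩ := h
    have : i = 0 := Fin.fin_one_eq_zero i
    subst this
    simp [hi]
  | succ z ih =>
    rcases hχ 0 with h0 | h0
    · have h' : ∃ i : Fin (z + 1), χ i.succ = 1 := by
        obtain ⟨i, hi⟩ := h
        have hi0 : i ≠ 0 := by rintro rfl; omega
        obtain ⟨j, rfl⟩ := Fin.exists_succ_eq.2 hi0
        exact ⟨j, hi⟩
      have := ih (fun i => χ i.succ) (fun i => hχ _) h'
      rw [Fin.sum_univ_succ, Fin.sum_univ_succ (f := χ), Fin.castSucc_zero, h0, zero_mul, zero_add,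
        zero_add]
      simpa only [Fin.succ_castSucc] using this
    · have := sum_consecutive_add_le χ hχ
      omega

variable {P : Type} {n r z b : ℕ}

/-- The vertices that will be joined to all hubs. -/
def Rigid : GadgetVert (Equiv.Perm (ReducedWord n r)) (P ⊕ Equiv.Perm (ReducedWord n r)) z b →
    Prop
  | core _ => False
  | unit (Sum.inr _) i => i ≠ 0
  | unit (Sum.inl _) _ => True
  | leaf _ _ => True

/-- Number of edges of the gadget graph inside a vertex set. -/
noncomputable def edgesIn {V : Type} (G : SimpleGraph V) (S : Set V) : ℕ :=
  {e ∈ G.edgeSet | ∀ x ∈ e, x ∈ S}.ncard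

theorem edgesIn_le_sum {V T : Type} [Fintype T] {G : SimpleGraph V} (f : T → V × V)
    (hf : ∀ e ∈ G.edgeSet, ∃ t, e = s((f t).1, (f t).2)) (S : Set V) (χ : V → ℕ)
    (hχ : ∀ x ∈ S, χ x = 1) :
    edgesIn G S ≤ ∑ t, χ (f t).1 * χ (f t).2 := by
  classical
  have hsub : {e ∈ G.edgeSet | ∀ x ∈ e, x ∈ S} ⊆ (fun t => s((f t).1, (f t).2)) ''
      ((Finset.univ.filter fun t => (f t).1 ∈ S ∧ (f t).2 ∈ S : Finset T) : Set T) := by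
    rintro e ⟨he, hS⟩
    obtain ⟨t, rfl⟩ := hf e he
    refine ⟨t, ?_, rfl⟩
    simpa using hS
  refine (Set.ncard_le_ncard hsub (Set.toFinite _)).trans ?_
  refine (Set.ncard_image_le (Set.toFinite _)).trans ?_
  rw [Set.ncard_coe_finset, Finset.card_filter]
  refine Finset.sum_le_sum fun t _ => ?_
  split_ifs with h
  · rw [hχ _ h.1, hχ _ h.2]
  · exact Nat.zero_le _

open Classical in
/-- Indicator function of a set. -/
noncomputable def ind {V : Type} (S : Set V) (x : V) : ℕ := if x ∈ S then 1 else 0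

theorem ind_eq {V : Type} (S : Set V) (x : V) : ind S x = 0 ∨ ind S x = 1 := by
  unfold ind; split_ifs <;> simp

theorem ind_le_one {V : Type} (S : Set V) (x : V) : ind S x ≤ 1 := by
  rcases ind_eq S x with h | h <;> omega

theorem ind_eq_one {V : Type} {S : Set V} {x : V} : ind S x = 1 ↔ x ∈ S := by
  unfold ind; split_ifs <;> simp_all

theorem ncard_eq_sum_ind {V : Type} [Fintype V] (S : Set V) : S.ncard = ∑ x, ind S x := by
  classical
  unfold ind
  rw [← Finset.card_filter, ← Set.ncard_coe_finset]
  congr 1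
  ext x
  simp

abbrev Grp (n r : ℕ) : Type := Equiv.Perm (ReducedWord n r)

variable (ρ : P → Grp n r) (S : Set (GadgetVert (Grp n r) (P ⊕ Grp n r) z b))

theorem edgesIn_graph_le [Fintype P] [Fintype (Grp n r)] :
    edgesIn (graph z b (attach ρ)) S ≤
      (∑ p : P, (∑ i : Fin z, ind S (unit (Sum.inl p) i.castSucc) * ind S (unit (Sum.inl p) i.succ)
        + ind S (core (ρ p)) * ind S (unit (Sum.inl p) 0)))
      + ∑ g : Grp n r, ∑ i : Fin z,
          ind S (unit (Sum.inr g) i.castSucc) * ind S (unit (Sum.inr g) i.succ)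
      + ∑ c : Grp n r, ∑ l : Fin b, ind S (core c) * ind S (leaf c l)
      + ∑ g : Grp n r, ∑ i : Fin n,
          ind S (core (g * ReducedWord.flip i)) * ind S (unit (Sum.inr g) 0) := by
  let f : (P × Fin z) ⊕ P ⊕ (Grp n r × Fin z) ⊕ (Grp n r × Fin b) ⊕ (Grp n r × Fin n) →
      GadgetVert (Grp n r) (P ⊕ Grp n r) z b × GadgetVert (Grp n r) (P ⊕ Grp n r) z b :=
    fun t => match t with
    | Sum.inl (p, i) => (unit (Sum.inl p) i.castSucc, unit (Sum.inl p) i.succ)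
    | Sum.inr (Sum.inl p) => (core (ρ p), unit (Sum.inl p) 0)
    | Sum.inr (Sum.inr (Sum.inl (g, i))) => (unit (Sum.inr g) i.castSucc, unit (Sum.inr g) i.succ)
    | Sum.inr (Sum.inr (Sum.inr (Sum.inl (c, l)))) => (core c, leaf c l)
    | Sum.inr (Sum.inr (Sum.inr (Sum.inr (g, i)))) =>
        (core (g * ReducedWord.flip i), unit (Sum.inr g) 0)
  have h := edgesIn_le_sum (G := graph z b (attach ρ)) f ?_ S (ind S)
    (fun x hx => ind_eq_one.2 hx)
  · simp only [Fintype.sum_sum_type, Fintype.sum_prod_type, f] at h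
    rw [Finset.sum_add_distrib]
    omega
  · rw [edgeSet_graph]
    rintro _ ⟨(⟨(p | g), i⟩ | ⟨c, l⟩ | ⟨⟨(p | g), c⟩, hp⟩), rfl⟩
    · exact ⟨Sum.inl (p, i), rfl⟩
    · exact ⟨Sum.inr (Sum.inr (Sum.inl (g, i))), rfl⟩
    · exact ⟨Sum.inr (Sum.inr (Sum.inr (Sum.inl (c, l)))), rfl⟩
    · refine ⟨Sum.inr (Sum.inl p), ?_⟩
      have hc : c = ρ p := hp
      subst hc
      rfl
    · obtain ⟨i, hi⟩ := hp
      refine ⟨Sum.inr (Sum.inr (Sum.inr (Sum.inr (g, i)))), ?_⟩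
      simp only at hi
      subst hi
      rfl

theorem ncard_eq_sum [Fintype P] [Fintype (Grp n r)] :
    S.ncard = ∑ c : Grp n r, ind S (core c)
      + ∑ p : P, ∑ i, ind S (unit (Sum.inl p) i)
      + ∑ g : Grp n r, ∑ i, ind S (unit (Sum.inr g) i)
      + ∑ c : Grp n r, ∑ l, ind S (leaf c l) := by
  classical
  have := Fintype.ofEquiv _ (equivSum (C := Grp n r) (U := P ⊕ Grp n r) (z := z) (b := b)).symm
  rw [ncard_eq_sum_ind, ← (equivSum (C := Grp n r) (U := P ⊕ Grp n r) (z := z)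
    (b := b)).symm.sum_comp]
  simp only [Fintype.sum_sum_type, Fintype.sum_prod_type, equivSum, Equiv.coe_fn_symm_mk]
  omega

theorem ncard_not_rigid [Fintype P] [Fintype (Grp n r)] :
    {x ∈ S | ¬ Rigid x}.ncard = ∑ c : Grp n r, ind S (core c)
      + ∑ g : Grp n r, ind S (unit (Sum.inr g) 0) := by
  rw [ncard_eq_sum]
  have h1 : ∀ c : Grp n r, ind {x ∈ S | ¬ Rigid x} (core c) = ind S (core c) := by
    intro c; unfold ind; congr 1; simp [Rigid]
  have h2 : ∀ (p : P) (i : Fin (z + 1)), ind {x ∈ S | ¬ Rigid x} (unit (Sum.inl p) i) = 0 := by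
    intro p i; simp [ind, Rigid]
  have h3 : ∀ (g : Grp n r), ∑ i : Fin (z + 1), ind {x ∈ S | ¬ Rigid x} (unit (Sum.inr g) i) =
      ind S (unit (Sum.inr g) 0) := by
    intro g
    have e1 : ind {x ∈ S | ¬ Rigid x} (unit (Sum.inr g) 0) = ind S (unit (Sum.inr g) 0) := by
      unfold ind; congr 1; simp [Rigid]
    have e2 : ∀ i : Fin z, ind {x ∈ S | ¬ Rigid x} (unit (Sum.inr g) i.succ) = 0 := by
      intro i; simp [ind, Rigid]
    rw [Fin.sum_univ_succ, e1]
    simp [e2]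
  have h4 : ∀ (c : Grp n r) (l : Fin b), ind {x ∈ S | ¬ Rigid x} (leaf c l) = 0 := by
    intro c l; simp [ind, Rigid]
  simp [h1, h2, h3, h4]

theorem ncard_rigid_add [Finite P] :
    {x ∈ S | Rigid x}.ncard + {x ∈ S | ¬ Rigid x}.ncard = S.ncard := by
  rw [← Set.ncard_union_eq]
  · congr 1
    ext x
    simp only [Set.mem_union, Set.mem_ofPred_eq]
    tauto
  · rw [Set.disjoint_left]
    exact fun x h h' => h'.2 h.2

/-- Double counting of the pairs between centres and shared units in `S`. -/
theorem sum_flip_swap [Fintype (Grp n r)] (u v : Grp n r → ℕ) :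
    ∑ g : Grp n r, ∑ i : Fin n, u (g * ReducedWord.flip i) * v g =
      ∑ c : Grp n r, ∑ i : Fin n, u c * v (c * ReducedWord.flip i) := by
  rw [Finset.sum_comm, Finset.sum_comm (γ := Grp n r)]
  refine Finset.sum_congr rfl fun i _ => ?_
  rw [← Equiv.sum_comp (Equiv.mulRight (ReducedWord.flip i : Grp n r))]
  refine Finset.sum_congr rfl fun g _ => ?_
  simp [mul_assoc, ReducedWord.flip_mul_flip]

/-- A weak bound for the number of edges inside a vertex set. -/
theorem two_mul_edgesIn_le [Finite P] :
    2 * edgesIn (graph z b (attach ρ)) S ≤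
      2 * {x ∈ S | Rigid x}.ncard + n * {x ∈ S | ¬ Rigid x}.ncard := by
  classical
  have := Fintype.ofFinite P
  have := Fintype.ofFinite (Grp n r)
  have h0 := ncard_rigid_add S
  have h1 := ncard_eq_sum S
  have h2 := ncard_not_rigid S
  have h3 := edgesIn_graph_le ρ S
  set A := ∑ c : Grp n r, ind S (core c)
  set B := ∑ g : Grp n r, ind S (unit (Sum.inr g) 0)
  set E := ∑ g : Grp n r, ∑ i : Fin n,
          ind S (core (g * ReducedWord.flip i)) * ind S (unit (Sum.inr g) 0) with hE
  have hB : E ≤ n * B := by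
    rw [hE, Finset.mul_sum]
    refine Finset.sum_le_sum fun g _ => ?_
    refine (Finset.sum_le_sum (g := fun _ => ind S (unit (Sum.inr g) 0)) fun i _ => ?_).trans ?_
    · exact (Nat.mul_le_mul_right _ (ind_le_one _ _)).trans (by simp)
    · simp
  have hA : E ≤ n * A := by
    rw [hE, sum_flip_swap (fun c => ind S (core c)) (fun g => ind S (unit (Sum.inr g) 0)),
      Finset.mul_sum]
    refine Finset.sum_le_sum fun g _ => ?_
    refine (Finset.sum_le_sum (g := fun _ => ind S (core g)) fun i _ => ?_).trans ?_
    · exact (Nat.mul_le_mul_left _ (ind_le_one _ _)).trans (by simp)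
    · simp
  have hpriv : ∀ p : P, (∑ i : Fin z, ind S (unit (Sum.inl p) i.castSucc) *
      ind S (unit (Sum.inl p) i.succ) + ind S (core (ρ p)) * ind S (unit (Sum.inl p) 0)) ≤
      ∑ i, ind S (unit (Sum.inl p) i) := by
    intro p
    refine le_trans (Nat.add_le_add_left ?_ _)
      (sum_consecutive_add_le (fun i => ind S (unit (Sum.inl p) i)) fun i => ind_eq _ _)
    exact (Nat.mul_le_mul_right _ (ind_le_one _ _)).trans (by simp)
  have hshared : ∀ g : Grp n r, (∑ i : Fin z, ind S (unit (Sum.inr g) i.castSucc) *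
      ind S (unit (Sum.inr g) i.succ)) + ind S (unit (Sum.inr g) 0) ≤
      ∑ i, ind S (unit (Sum.inr g) i) := fun g =>
    sum_consecutive_add_le (fun i => ind S (unit (Sum.inr g) i)) fun i => ind_eq _ _
  have hleaf : ∀ c : Grp n r, ∑ l : Fin b, ind S (core c) * ind S (leaf c l) ≤
      ∑ l : Fin b, ind S (leaf c l) := fun c => Finset.sum_le_sum fun l _ =>
    (Nat.mul_le_mul_right _ (ind_le_one _ _)).trans (by simp)
  have s1 := Finset.sum_le_sum fun p (_ : p ∈ Finset.univ) => hpriv p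
  have s2 := Finset.sum_le_sum fun p (_ : p ∈ Finset.univ) => hshared p
  have s3 := Finset.sum_le_sum fun p (_ : p ∈ Finset.univ) => hleaf p
  rw [Finset.sum_add_distrib] at s2
  change _ + B ≤ _ at s2
  have : n * (A + B) = n * A + n * B := by ring
  rw [h2, this]
  omega

/-- The number of pairs of a vertex of `v` and a vertex of `u` related by a flip exceeds neither side;
the last alternative means that the two sets are closed under flips. -/
theorem card_shared_le [Fintype (Grp n r)] (hn : 2 ≤ n) {u v : Grp n r → ℕ}
    (hu : ∀ g, u g = 0 ∨ u g = 1) (hv : ∀ g, v g = 0 ∨ v g = 1) :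
    ∃ t, (∑ g : Grp n r, ∑ i : Fin n, u (g * ReducedWord.flip i) * v g) + t = n * ∑ g, v g ∧
      (∑ g, v g + u 1 ≤ t + ∑ g, u g ∨ (∑ g, v g ≤ ∑ g, u g ∧ t = 0 ∧ r / 2 < ∑ g, u g)) := by
  classical
  set E := ∑ g : Grp n r, ∑ i : Fin n, u (g * ReducedWord.flip i) * v g with hE
  have hV : E + ∑ g : Grp n r, ∑ i : Fin n, (1 - u (g * ReducedWord.flip i)) * v g =
      n * ∑ g, v g := by
    rw [hE, ← Finset.sum_add_distrib, Finset.mul_sum]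
    refine Finset.sum_congr rfl fun g _ => ?_
    rw [← Finset.sum_add_distrib]
    rw [Finset.sum_congr rfl (g := fun _ => v g), Finset.sum_const]
    · simp
    · intro i _
      rcases hu (g * ReducedWord.flip i) with h | h <;> simp [h]
  have hU : E + ∑ c : Grp n r, ∑ i : Fin n, u c * (1 - v (c * ReducedWord.flip i)) =
      n * ∑ g, u g := by
    rw [hE, sum_flip_swap, ← Finset.sum_add_distrib, Finset.mul_sum]
    refine Finset.sum_congr rfl fun g _ => ?_
    rw [← Finset.sum_add_distrib]
    rw [Finset.sum_congr rfl (g := fun _ => u g), Finset.sum_const]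
    · simp
    · intro i _
      rcases hv (g * ReducedWord.flip i) with h | h <;> simp [h]
  set t := ∑ g : Grp n r, ∑ i : Fin n, (1 - u (g * ReducedWord.flip i)) * v g with ht
  set t' := ∑ c : Grp n r, ∑ i : Fin n, u c * (1 - v (c * ReducedWord.flip i)) with ht'
  refine ⟨t, hV, ?_⟩
  rcases hu 1 with h1 | h1
  · left
    rcases le_total (∑ g, v g) (∑ g, u g) with h | h
    · omega
    · obtain ⟨δ, hδ⟩ := Nat.exists_eq_add_of_le h
      rw [hδ, mul_add] at hV
      have : δ ≤ n * δ := Nat.le_mul_of_pos_left _ (by omega)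
      omega
  rcases lt_trichotomy (∑ g, v g) (∑ g, u g) with h | h | h
  · left; omega
  · rcases Nat.eq_zero_or_pos t with h0 | h0
    · right
      refine ⟨h.le, h0, ?_⟩
      -- As the two sets have equal size, absence of missing pairs on one side gives it on the
      -- other, so no flip leads out of either set.
      have h0' : t' = 0 := by rw [h] at hV; omega
      have c1 : ∀ g i, v g = 1 → u (g * ReducedWord.flip i) = 1 := by
        intro g i hg
        rw [ht, Finset.sum_eq_zero_iff] at h0
        have := Finset.sum_eq_zero_iff.1 (h0 g (Finset.mem_univ _)) i (Finset.mem_univ _)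
        rw [hg, mul_one] at this
        rcases hu (g * ReducedWord.flip i) with h | h <;> omega
      have c2 : ∀ g i, u g = 1 → v (g * ReducedWord.flip i) = 1 := by
        intro g i hg
        rw [ht', Finset.sum_eq_zero_iff] at h0'
        have := Finset.sum_eq_zero_iff.1 (h0' g (Finset.mem_univ _)) i (Finset.mem_univ _)
        rw [hg, one_mul] at this
        rcases hv (g * ReducedWord.flip i) with h | h <;> omega
      refine (ReducedWord.lt_ncard_of_closed hn (A := {g | u g = 1}) h1
        fun g hg i j => c1 _ j (c2 g i hg)).trans_le ?_
      rw [ncard_eq_sum_ind]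
      refine Finset.sum_le_sum fun g _ => ?_
      rcases hu g with h | h <;> simp [ind, h]
    · left; omega
  · left
    obtain ⟨δ, hδ⟩ := Nat.exists_eq_add_of_le h.le
    rw [hδ, mul_add] at hV
    -- A surplus `δ ≥ 1` of `v` over `u` forces `n * δ ≥ δ + 1` missing pairs, which also pays for
    -- `u 1 = 1`.
    have : 2 * δ ≤ n * δ := Nat.mul_le_mul_right _ hn
    omega

/-- The private units: `n - 1` at each centre and one additional unit at the centre `1`. -/
def root {k : ℕ} : Option (Grp n r × Fin k) → Grp n r
  | none => 1
  | some p => p.1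

open Classical in
/-- Sharp bound for the number of edges inside a vertex set. -/
theorem mul_edgesIn_le {k d : ℕ} (hk : 1 ≤ k) (hd : d = (k + 1) * z + 1 + b)
    (S : Set (GadgetVert (Grp (k + 1) r) (Option (Grp (k + 1) r × Fin k) ⊕ Grp (k + 1) r) z b)) :
    (d + k + 1) * edgesIn (graph z b (attach root)) S ≤
      k * (d + k + 1) * {x ∈ S | ¬ Rigid x}.ncard + d * S.ncard +
        (if r / 2 < S.ncard then (k + 1) * (z + 1) else 0) := by
  have := Fintype.ofFinite (Grp (k + 1) r)
  have h1 := ncard_eq_sum S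
  have h2 := ncard_not_rigid S
  have h3 := edgesIn_graph_le root S
  obtain ⟨t, ht, hcase⟩ := card_shared_le (r := r) (n := k + 1) (by omega)
    (u := fun c => ind S (core c)) (v := fun g => ind S (unit (Sum.inr g) 0))
    (fun _ => ind_eq _ _) (fun _ => ind_eq _ _)
  set m := d + k + 1 with hm
  set Q := (k + 1) * (z + 1) with hQ
  have hmQ : m = Q + 1 + b := by rw [hm, hQ, hd]; ring
  set A := ∑ c : Grp (k + 1) r, ind S (core c) with hA
  set B := ∑ g : Grp (k + 1) r, ind S (unit (Sum.inr g) 0) with hB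
  set E := ∑ g : Grp (k + 1) r, ∑ i : Fin (k + 1),
          ind S (core (g * ReducedWord.flip i)) * ind S (unit (Sum.inr g) 0) with hE
  -- Weights: an edge costs `m = d + (k + 1)` and a vertex pays `d`. A nonempty part of a unit,
  -- counted with one edge to a centre, needs at most `k + 1` more per vertex, hence at most `Q`;
  -- without that edge its vertices pay for everything.
  have hpath : ∀ a, (m * ∑ i : Fin z, ind S (unit a i.castSucc) * ind S (unit a i.succ)) ≤
      d * ∑ i, ind S (unit a i) ∧
      m * (∑ i : Fin z, ind S (unit a i.castSucc) * ind S (unit a i.succ)) +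
        m * ind S (unit a 0) ≤ d * ∑ i, ind S (unit a i) + Q * ind S (unit a 0) := by
    intro a
    have hs : ∑ i, ind S (unit a i) ≤ z + 1 := by
      refine (Finset.sum_le_sum fun i _ => ind_le_one _ _).trans ?_
      simp
    have e1 : m * ∑ i, ind S (unit a i) = d * ∑ i, ind S (unit a i) +
      (k + 1) * ∑ i, ind S (unit a i) := by rw [hm]; ring
    have e2 : (k + 1) * ∑ i, ind S (unit a i) ≤ Q := Nat.mul_le_mul_left _ hs
    by_cases hne : ∃ i, ind S (unit a i) = 1
    · have h := sum_consecutive_lt (fun i => ind S (unit a i)) (fun i => ind_eq _ _) hne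
      have h' := Nat.mul_le_mul_left m h
      rw [mul_add, mul_one] at h'
      refine ⟨by omega, ?_⟩
      rcases ind_eq S (unit a 0) with h0 | h0
      · rw [h0]; omega
      · rw [h0]; omega
    · have h0 : ∀ i, ind S (unit a i) = 0 := fun i =>
        (ind_eq S (unit a i)).resolve_right fun h => hne ⟨i, h⟩
      simp [h0]
  have hpriv : ∀ p : Option (Grp (k + 1) r × Fin k),
      m * (∑ i : Fin z, ind S (unit (Sum.inl p) i.castSucc) * ind S (unit (Sum.inl p) i.succ)
        + ind S (core (root p)) * ind S (unit (Sum.inl p) 0)) ≤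
      d * ∑ i, ind S (unit (Sum.inl p) i) + Q * ind S (core (root p)) := by
    intro p
    obtain ⟨e1, e2⟩ := hpath (Sum.inl p)
    rcases ind_eq S (core (root p)) with h | h
    · rw [h]; simpa using e1
    · rw [h, one_mul, mul_add]
      refine e2.trans (Nat.add_le_add_left (Nat.mul_le_mul_left _ (ind_le_one _ _)) _)
  have hleaf : ∀ c : Grp (k + 1) r, ∀ l : Fin b, m * (ind S (core c) * ind S (leaf c l)) ≤
      d * ind S (leaf c l) + (k + 1) * ind S (core c) := by
    intro c l
    rcases ind_eq S (core c) with h | h <;> rcases ind_eq S (leaf c l) with h' | h' <;>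
      simp only [h, h'] <;> omega
  have s1 := Finset.sum_le_sum fun p (_ : p ∈ Finset.univ) => hpriv p
  have s2 := Finset.sum_le_sum fun g (_ : g ∈ (Finset.univ : Finset (Grp (k + 1) r))) =>
    (hpath (Sum.inr g)).2
  have s3 := Finset.sum_le_sum fun c (_ : c ∈ (Finset.univ : Finset (Grp (k + 1) r))) =>
    Finset.sum_le_sum fun l (_ : l ∈ Finset.univ) => hleaf c l
  have hroots : ∑ p : Option (Grp (k + 1) r × Fin k), ind S (core (root p)) =
      ind S (core 1) + k * A := by
    rw [Fintype.sum_option, Fintype.sum_prod_type]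
    simp [root, hA, Finset.mul_sum]
  simp only [Finset.sum_add_distrib, ← Finset.mul_sum, Finset.sum_const, Finset.card_univ,
    Fintype.card_fin, smul_eq_mul] at s1 s2 s3
  rw [hroots] at s1
  rw [← hB] at s2
  rw [← hA] at s3
  simp only [Finset.sum_add_distrib] at h3
  have h3' := Nat.mul_le_mul_left m h3
  have hmt : m * E + m * t = m * ((k + 1) * B) := by rw [← mul_add, ht]
  have hdS := congrArg (d * ·) h1
  simp only [mul_add] at h3' s1 hdS
  have e1 : m * ((k + 1) * B) = k * m * B + m * B := by ring
  -- Per centre: `k` private units, `b` leaves and the share `Q` for shared units cost `(k + 1) * (Q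
  -- + b) = (k + 1) * (m - 1) = k * m + d`, exactly what a non-rigid vertex may pay.
  have e2 : Q * (k * A) + (k + 1) * (b * A) + Q * A = k * m * A + d * A := by
    rw [hmQ, hQ, hd]; ring
  have e3 : b * ((k + 1) * A) = (k + 1) * (b * A) := by ring
  have goal1 : m * edgesIn (graph z b (attach root)) S + m * t + Q * A ≤
      k * m * (A + B) + d * S.ncard + Q * B + Q * ind S (core 1) := by
    rw [mul_add (k * m)]
    have hl : ∑ c : Grp (k + 1) r, ∑ l : Fin b, ind S (core c) * ind S (leaf c l) =
        ∑ c : Grp (k + 1) r, ind S (core c) * ∑ l : Fin b, ind S (leaf c l) := by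
      simp only [Finset.mul_sum]
    rw [hl] at h3'
    omega
  rw [h2]
  -- Missing pairs save `m ≥ Q` each. Only in the closed case does the extra private unit at `1`
  -- remain unpaid, with cost `Q`.
  rcases hcase with hcase | ⟨hBA, ht0, hr⟩
  · have h4 := Nat.mul_le_mul_left Q hcase
    have h5 : Q * t ≤ m * t := Nat.mul_le_mul_right _ (by omega)
    simp only [mul_add] at h4
    omega
  · have hS : A ≤ S.ncard := by omega
    rw [if_pos (by omega)]
    have h4 := Nat.mul_le_mul_left Q hBA
    have h5 : Q * ind S (core 1) ≤ Q * 1 := Nat.mul_le_mul_left _ (ind_le_one _ _)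
    omega

end GadgetVert

/-! ### Many copies joined to hubs: a clean copy and the fractional arboricity. -/

open GadgetVert

/-- `q` disjoint copies of `X` together with `k` hubs, each joined to all vertices satisfying `R`. -/
def hubGraph {V : Type} (k q : ℕ) (X : SimpleGraph V) (R : V → Prop) :
    SimpleGraph (Fin k ⊕ (Fin q × V)) where
  Adj x y := match x, y with
    | Sum.inl _, Sum.inl _ => False
    | Sum.inl _, Sum.inr p => R p.2
    | Sum.inr p, Sum.inl _ => R p.2
    | Sum.inr p, Sum.inr p' => p.1 = p'.1 ∧ X.Adj p.2 p'.2
  symm := ⟨by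
    rintro (h | ⟨i, x⟩) (h' | ⟨j, y⟩) hxy
    · exact hxy
    · exact hxy
    · exact hxy
    · exact ⟨hxy.1.symm, hxy.2.symm⟩⟩
  loopless := ⟨by
    rintro (h | ⟨i, x⟩) hxy
    · exact hxy
    · exact hxy.2.ne rfl⟩

namespace hubGraph

variable {V : Type} {k q : ℕ} {X : SimpleGraph V} {R : V → Prop}

def copy (k : ℕ) {q : ℕ} (i : Fin q) : V ↪ Fin k ⊕ (Fin q × V) :=
  ⟨fun x => Sum.inr (i, x), fun x y h => by simpa using h⟩

theorem le_ncard_edgeSet [Finite V] :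
    q * X.edgeSet.ncard + k * (q * {x | R x}.ncard) ≤ (hubGraph k q X R).edgeSet.ncard := by
  let f : (Fin q × X.edgeSet) ⊕ (Fin k × Fin q × {x | R x}) → (hubGraph k q X R).edgeSet :=
    fun t => match t with
    | Sum.inl (i, e) => ⟨e.1.map (copy k i), by
        obtain ⟨e, he⟩ := e
        induction e with | _ x y
        exact ⟨rfl, he⟩⟩
    | Sum.inr (h, i, x) => ⟨s(Sum.inl h, Sum.inr (i, x.1)), x.2⟩
  have hf : Function.Injective f := by
    rintro (⟨i, e, he⟩ | ⟨h, i, x⟩) (⟨i', e', he'⟩ | ⟨h', i', x'⟩) heq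
    · have heq' := Subtype.ext_iff.1 heq
      induction e with | _ x y
      induction e' with | _ x' y'
      change s(Sum.inr (i, x), Sum.inr (i, y)) = s(Sum.inr (i', x'), Sum.inr (i', y')) at heq'
      simp only [Sym2.eq_iff, Sum.inr.injEq, Prod.mk.injEq] at heq'
      simp only [Sum.inl.injEq, Prod.mk.injEq, Subtype.mk.injEq, Sym2.eq_iff]
      tauto
    · have heq' := Subtype.ext_iff.1 heq
      induction e with | _ x y
      simp [f, copy] at heq'
    · have heq' := Subtype.ext_iff.1 heq
      induction e' with | _ x y
      simp [f, copy] at heq'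
    · have heq' := Subtype.ext_iff.1 heq
      simp [f] at heq'
      grind
  have := Nat.card_le_card_of_injective f hf
  rwa [Nat.card_sum, Nat.card_prod, Nat.card_prod, Nat.card_prod, Nat.card_coe_set_eq,
    Nat.card_coe_set_eq, Nat.card_coe_set_eq, Nat.card_fin, Nat.card_fin] at this

theorem comap_copy_le {F : SimpleGraph (Fin k ⊕ (Fin q × V))} (hF : F ≤ hubGraph k q X R)
    (i : Fin q) : F.comap (copy k i) ≤ X := fun _ _ h => (hF h).2

theorem ncard_edgeSet_le [Finite V] {F : SimpleGraph (Fin k ⊕ (Fin q × V))}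
    (hF : F ≤ hubGraph k q X R) :
    F.edgeSet.ncard ≤ ∑ i : Fin q, (F.comap (copy k i)).edgeSet.ncard +
      ∑ h : Fin k, (F.neighborSet (Sum.inl h)).ncard := by
  have hsub : F.edgeSet ⊆ (⋃ i ∈ (Finset.univ : Finset (Fin q)),
      Sym2.map (copy k i) '' (F.comap (copy k i)).edgeSet) ∪
      ⋃ h ∈ (Finset.univ : Finset (Fin k)),
        (fun y => s(Sum.inl h, y)) '' F.neighborSet (Sum.inl h) := by
    intro e
    induction e with | _ x y
    intro he
    rcases x with h | ⟨i, x⟩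
    · right
      simp only [Set.mem_iUnion]
      exact ⟨h, Finset.mem_univ _, y, he, rfl⟩
    rcases y with h | ⟨j, y⟩
    · right
      simp only [Set.mem_iUnion]
      exact ⟨h, Finset.mem_univ _, _, SimpleGraph.Adj.symm he, Sym2.eq_swap⟩
    · left
      have hij : i = j := (hF he).1
      subst hij
      simp only [Set.mem_iUnion]
      exact ⟨i, Finset.mem_univ _, s(x, y), he, rfl⟩
  refine (Set.ncard_le_ncard hsub (Set.toFinite _)).trans ?_
  refine (Set.ncard_union_le _ _).trans (Nat.add_le_add ?_ ?_)
  · refine (Finset.set_ncard_biUnion_le _ _).trans ?_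
    exact Finset.sum_le_sum fun i _ => Set.ncard_image_le (Set.toFinite _)
  · refine (Finset.set_ncard_biUnion_le _ _).trans ?_
    exact Finset.sum_le_sum fun i _ => Set.ncard_image_le (Set.toFinite _)

open Classical in
/-- If there are many copies, then a part of bounded degree of a decomposition into pseudoforests
has many edges in some copy without using edges between the hubs and this copy. -/
theorem exists_copy [Finite V] {D : ℕ}
    (hq : k * k + k * D + k * D * (k * Nat.card V + 1) < q)
    {F : Fin (k + 1) → SimpleGraph (Fin k ⊕ (Fin q × V))}
    (hF : (hubGraph k q X R).IsDecomposition F) (hps : ∀ i, (F i).IsPseudoforest)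
    (j : Fin (k + 1)) (hD : ∀ v, ((F j).neighborSet v).encard ≤ (D : ℕ∞)) :
    ∃ i : Fin q, (∀ h x, ¬ (F j).Adj (Sum.inl h) (copy k i x)) ∧
      X.edgeSet.ncard + k * {x | R x}.ncard ≤
        ((F j).comap (copy k i)).edgeSet.ncard + k * Nat.card V := by
  by_contra! hno
  have hle : F j ≤ hubGraph k q X R := by
    rw [← SimpleGraph.edgeSet_subset_edgeSet, ← hF.2]
    exact Set.subset_iUnion (fun i => (F i).edgeSet) j
  have hdeg : ∀ v, ((F j).neighborSet v).ncard ≤ D := fun v => by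
    have := hD v
    rwa [← Set.Finite.cast_ncard_eq (Set.toFinite _), Nat.cast_le] at this
  -- Each of the other `k` pseudoforests has at most as many edges as there are vertices.
  have h1 : (hubGraph k q X R).edgeSet.ncard ≤ (F j).edgeSet.ncard +
      k * (k + q * Nat.card V) := by
    have hsub : (hubGraph k q X R).edgeSet ⊆
        ⋃ i ∈ (Finset.univ : Finset (Fin (k + 1))), (F i).edgeSet := by
      rw [← hF.2]; simp
    refine (Set.ncard_le_ncard hsub (Set.toFinite _)).trans ?_
    refine (Finset.set_ncard_biUnion_le _ _).trans ?_
    rw [← Finset.add_sum_erase _ _ (Finset.mem_univ j)]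
    refine Nat.add_le_add_left ((Finset.sum_le_card_nsmul _ _ (k + q * Nat.card V) ?_).trans ?_) _
    · intro i _
      have := (hps i).ncard_edgeSet_le
      rwa [Nat.card_sum, Nat.card_prod, Nat.card_fin, Nat.card_fin] at this
    · rw [Finset.card_erase_of_mem (Finset.mem_univ _)]
      simp
  have h2 := le_ncard_edgeSet (k := k) (q := q) (X := X) (R := R)
  have h3 := ncard_edgeSet_le hle
  have h4 : ∑ h : Fin k, ((F j).neighborSet (Sum.inl h)).ncard ≤ k * D := by
    refine (Finset.sum_le_sum fun h _ => hdeg (Sum.inl h)).trans ?_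
    simp
  set I := Finset.univ.filter fun i : Fin q => ∃ h x, (F j).Adj (Sum.inl h) (copy k i x) with hI
  have h5 : I.card ≤ k * D := by
    refine le_trans ?_ h4
    have hsub : (I.image some : Set (Option (Fin q))) ⊆ ⋃ h ∈ (Finset.univ : Finset (Fin k)),
        (fun y : Fin k ⊕ (Fin q × V) => Sum.elim (fun _ => none) (fun p => some p.1) y) ''
          (F j).neighborSet (Sum.inl h) := by
      intro i hi
      simp only [Finset.coe_image, Set.mem_image, Finset.mem_coe] at hi
      obtain ⟨i, hi, rfl⟩ := hi
      obtain ⟨h, x, hx⟩ := (Finset.mem_filter.1 hi).2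
      simp only [Set.mem_iUnion]
      exact ⟨h, Finset.mem_univ _, copy k i x, hx, rfl⟩
    have := Set.ncard_le_ncard hsub (Set.toFinite _)
    rw [Set.ncard_coe_finset, Finset.card_image_of_injective _ (Option.some_injective _)] at this
    refine this.trans ((Finset.set_ncard_biUnion_le _ _).trans ?_)
    exact Finset.sum_le_sum fun i _ => Set.ncard_image_le (Set.toFinite _)
  -- If no clean copy were rich, each would fall short by one edge. The copies in `I`, at most `k *
  -- D` of them, get the correction `k * Nat.card V + 1`, so the deficit grows with `q` while all
  -- error terms are bounded.
  have h6 : ∀ i : Fin q, ((F j).comap (copy k i)).edgeSet.ncard + (k * Nat.card V + 1) ≤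
      X.edgeSet.ncard + k * {x | R x}.ncard + (if i ∈ I then (k * Nat.card V + 1) else 0) := by
    intro i
    split_ifs with hi
    · have : ((F j).comap (copy k i)).edgeSet.ncard ≤ X.edgeSet.ncard :=
        Set.ncard_le_ncard (SimpleGraph.edgeSet_subset_edgeSet.2 (comap_copy_le hle i))
          (Set.toFinite _)
      omega
    · have := hno i fun h x hx => hi (Finset.mem_filter.2 ⟨Finset.mem_univ _, h, x, hx⟩)
      omega
  have h7 := Finset.sum_le_sum fun i (_ : i ∈ Finset.univ) => h6 i
  simp only [Finset.sum_add_distrib, Finset.sum_ite_mem, Finset.univ_inter, Finset.sum_const,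
    Finset.card_univ, Fintype.card_fin, smul_eq_mul] at h7
  have h8 : I.card * (k * Nat.card V + 1) ≤ k * D * (k * Nat.card V + 1) :=
    Nat.mul_le_mul_right _ h5
  rw [mul_add, mul_one] at h8
  have e1 : q * (k * Nat.card V) = k * (q * Nat.card V) := by ring
  have e2 : q * (k * {x | R x}.ncard) = k * (q * {x | R x}.ncard) := by ring
  have e3 : k * (k + q * Nat.card V) = k * k + k * (q * Nat.card V) := by ring
  omega

/-- The edges of a subgraph of the hub graph. -/
theorem ncard_edgeSet_subgraph_le [Finite V] (H : (hubGraph k q X R).Subgraph) :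
    H.edgeSet.ncard ≤ ∑ i : Fin q, (edgesIn X {x | copy k i x ∈ H.verts} +
      {h : Fin k | Sum.inl h ∈ H.verts}.ncard * {x ∈ {x | copy k i x ∈ H.verts} | R x}.ncard) := by
  have hsub : H.edgeSet ⊆ ⋃ i ∈ (Finset.univ : Finset (Fin q)),
      (Sym2.map (copy k i) '' {e ∈ X.edgeSet | ∀ x ∈ e, x ∈ {x | copy k i x ∈ H.verts}} ∪
      (fun p : Fin k × V => s(Sum.inl p.1, copy k i p.2)) ''
        ({h : Fin k | Sum.inl h ∈ H.verts} ×ˢ {x ∈ {x | copy k i x ∈ H.verts} | R x})) := by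
    intro e
    induction e with | _ x y
    intro he
    have he' : H.Adj x y := he
    have hadj := he'.adj_sub
    simp only [Set.mem_iUnion]
    rcases x with h | ⟨i, x⟩ <;> rcases y with h' | ⟨j, y⟩
    · exact hadj.elim
    · exact ⟨j, Finset.mem_univ _, Or.inr ⟨(h, y), ⟨he'.fst_mem, he'.snd_mem, hadj⟩, rfl⟩⟩
    · exact ⟨i, Finset.mem_univ _, Or.inr ⟨(h', x), ⟨he'.snd_mem, he'.fst_mem, hadj⟩,
        Sym2.eq_swap⟩⟩
    · have hij : i = j := hadj.1
      subst hij
      refine ⟨i, Finset.mem_univ _, Or.inl ⟨s(x, y), ⟨hadj.2, ?_⟩, rfl⟩⟩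
      intro w hw
      rcases Sym2.mem_iff.1 hw with rfl | rfl
      · exact he'.fst_mem
      · exact he'.snd_mem
  refine (Set.ncard_le_ncard hsub (Set.toFinite _)).trans ?_
  refine (Finset.set_ncard_biUnion_le _ _).trans (Finset.sum_le_sum fun i _ => ?_)
  refine (Set.ncard_union_le _ _).trans (Nat.add_le_add ?_ ?_)
  · exact Set.ncard_image_le (Set.toFinite _)
  · refine (Set.ncard_image_le (Set.toFinite _)).trans ?_
    rw [Set.ncard_prod]

theorem ncard_eq_add_sum [Finite V] (T : Set (Fin k ⊕ (Fin q × V))) :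
    T.ncard = {h : Fin k | Sum.inl h ∈ T}.ncard + ∑ i : Fin q, {x | copy k i x ∈ T}.ncard := by
  have := Fintype.ofFinite V
  simp only [ncard_eq_sum_ind, Fintype.sum_sum_type, Fintype.sum_prod_type]
  rfl

theorem _root_.SimpleGraph.Subgraph.two_mul_ncard_edgeSet_le {W : Type} [Finite W]
    {G : SimpleGraph W} (H : G.Subgraph) :
    2 * H.edgeSet.ncard ≤ H.verts.ncard * (H.verts.ncard - 1) := by
  classical
  have := Fintype.ofFinite W
  have h1 : H.edgeSet.ncard ≤ H.coe.edgeSet.ncard := by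
    rw [← SimpleGraph.Subgraph.image_coe_edgeSet_coe]
    exact Set.ncard_image_le (Set.toFinite _)
  have h2 := H.coe.card_edgeFinset_le_card_choose_two
  rw [← Set.ncard_coe_finset, SimpleGraph.coe_edgeFinset, ← Nat.card_eq_fintype_card,
    Nat.card_coe_set_eq] at h2
  have h3 := Nat.choose_two_right H.verts.ncard
  have h4 := Nat.div_mul_le_self (H.verts.ncard * (H.verts.ncard - 1)) 2
  omega

/-- With a hub in the subgraph, `v(H) - 1` is at least the number of its vertices in the copies, and
`h1` can be summed over copies. Without hubs the cruder `h2` already gives `e(H) ≤ k * (v(H) - 1)`;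
this needs `k ≥ 2`. -/
theorem fractionalArboricity_le [Finite V] (hk : 2 ≤ k) {θ : ℝ} (hθ : 0 ≤ θ)
    (h1 : ∀ S : Set V, (edgesIn X S : ℝ) ≤ k * {x ∈ S | ¬ R x}.ncard + θ * S.ncard)
    (h2 : ∀ S : Set V, 2 * edgesIn X S ≤ 2 * {x ∈ S | R x}.ncard +
      (k + 1) * {x ∈ S | ¬ R x}.ncard) :
    (hubGraph k q X R).fractionalArboricity ≤ k + θ := by
  refine Real.sSup_le ?_ (by positivity)
  rintro _ ⟨H, hH, rfl⟩
  have hH' : (2 : ℝ) ≤ H.verts.ncard := by exact_mod_cast hH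
  rw [div_le_iff₀ (by linarith)]
  have hE := ncard_edgeSet_subgraph_le H
  have hV := ncard_eq_add_sum H.verts
  have hsplit : ∀ i : Fin q, {x ∈ {x | copy k i x ∈ H.verts} | R x}.ncard +
      {x ∈ {x | copy k i x ∈ H.verts} | ¬ R x}.ncard = {x | copy k i x ∈ H.verts}.ncard := by
    intro i
    rw [← Set.ncard_union_eq]
    · congr 1
      ext x
      simp only [Set.mem_union, Set.mem_ofPred_eq]
      tauto
    · rw [Set.disjoint_left]
      exact fun x h h' => h'.2 h.2
  set p := {h : Fin k | Sum.inl h ∈ H.verts}.ncard with hp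
  have hpk : p ≤ k := by
    have := Set.ncard_le_card {h : Fin k | Sum.inl h ∈ H.verts}
    simpa using this
  rcases Nat.eq_zero_or_pos p with h0 | h0
  · have hc := H.two_mul_ncard_edgeSet_le
    have hS : 2 * H.edgeSet.ncard ≤ (k + 1) * H.verts.ncard := by
      rw [h0] at hE hV
      simp only [zero_mul, add_zero, zero_add] at hE hV
      rw [hV, Finset.mul_sum]
      refine (Nat.mul_le_mul_left 2 hE).trans ?_
      rw [Finset.mul_sum]
      refine Finset.sum_le_sum fun i _ => (h2 _).trans ?_
      rw [← hsplit i, mul_add]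
      exact Nat.add_le_add_right (Nat.mul_le_mul_right _ (by omega)) _
    obtain ⟨t, ht⟩ := Nat.exists_eq_add_of_le hH
    have hfin : H.edgeSet.ncard ≤ k * (t + 1) := by
      rw [ht] at hc hS
      rw [show 2 + t - 1 = t + 1 by omega] at hc
      -- On two or three vertices the complete graph is sparse enough; from four vertices on, `(k +
      -- 1) * v / 2 ≤ k * (v - 1)`.
      by_cases h3 : t ≤ 1
      · interval_cases t <;> omega
      · nlinarith
    have hfin' : (H.edgeSet.ncard : ℝ) ≤ k * (t + 1) := by exact_mod_cast hfin
    rw [ht]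
    push_cast
    nlinarith [(Nat.cast_nonneg t : (0 : ℝ) ≤ t)]
  · have hV' : (H.verts.ncard : ℝ) - 1 ≥ ∑ i : Fin q, ({x | copy k i x ∈ H.verts}.ncard : ℝ) := by
      rw [hV]
      push_cast
      have : (1 : ℝ) ≤ p := by exact_mod_cast h0
      linarith
    refine le_trans ?_ (mul_le_mul_of_nonneg_left hV' (by positivity))
    rw [Finset.mul_sum]
    refine le_trans (Nat.cast_le.2 hE) ?_
    push_cast
    refine Finset.sum_le_sum fun i _ => ?_
    have e1 := h1 {x | copy k i x ∈ H.verts}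
    have e2 : ({x ∈ {x | copy k i x ∈ H.verts} | R x}.ncard : ℝ) +
      {x ∈ {x | copy k i x ∈ H.verts} | ¬ R x}.ncard = {x | copy k i x ∈ H.verts}.ncard := by
      exact_mod_cast hsplit i
    have e3 : (p : ℝ) * {x ∈ {x | copy k i x ∈ H.verts} | R x}.ncard ≤
        k * {x ∈ {x | copy k i x ∈ H.verts} | R x}.ncard := by
      gcongr
    rw [add_mul, ← e2, mul_add (k : ℝ), e2]
    linarith

end hubGraph


/-! ### Counting the whole gadget, and the theorem. -/

theorem GadgetVert.natCard_attach_ge {k r : ℕ} (hr : 2 ≤ r) :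
    Nat.card (Grp (k + 1) r) * k + 1 + Nat.card (Grp (k + 1) r) * (k + 1) ≤
      Nat.card {p : (Option (Grp (k + 1) r × Fin k) ⊕ Grp (k + 1) r) × Grp (k + 1) r //
        attach root p.1 p.2} := by
  let f : Option (Grp (k + 1) r × Fin k) ⊕ (Grp (k + 1) r × Fin (k + 1)) →
      {p : (Option (Grp (k + 1) r × Fin k) ⊕ Grp (k + 1) r) × Grp (k + 1) r //
        attach root p.1 p.2} := fun t => match t with
    | Sum.inl p => ⟨(Sum.inl p, root p), rfl⟩
    | Sum.inr (g, i) => ⟨(Sum.inr g, g * ReducedWord.flip i), i, rfl⟩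
  have hf : Function.Injective f := by
    rintro (p | ⟨g, i⟩) (p' | ⟨g', i'⟩) h
    · have := congrArg (fun x => x.1.1) h
      simpa [f] using this
    · have := congrArg (fun x => x.1.1) h
      simp [f] at this
    · have := congrArg (fun x => x.1.1) h
      simp [f] at this
    · have h1 := congrArg (fun x => x.1.1) h
      have h2 := congrArg (fun x => x.1.2) h
      simp only [f, Sum.inr.injEq] at h1 h2
      subst h1
      rw [ReducedWord.flip_injective hr (mul_left_cancel h2)]
  have := Nat.card_le_card_of_injective f hf
  rwa [Nat.card_sum, Finite.card_option, Nat.card_prod, Nat.card_prod, Nat.card_fin,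
    Nat.card_fin] at this

/-- The number of edges of the gadget graph exceeds what `k` pseudoforests can take, even if each
rigid vertex has `k` further edges. -/
theorem GadgetVert.excess {k r : ℕ} (hr : 2 ≤ r) (z b : ℕ) :
    Nat.card (GadgetVert (Grp (k + 1) r) (Option (Grp (k + 1) r × Fin k) ⊕ Grp (k + 1) r) z b) + 1 +
      k * Nat.card (GadgetVert (Grp (k + 1) r)
        (Option (Grp (k + 1) r × Fin k) ⊕ Grp (k + 1) r) z b) ≤
    (graph z b (attach (root (n := k + 1) (r := r) (k := k)))).edgeSet.ncard +
      k * {x : GadgetVert (Grp (k + 1) r)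
        (Option (Grp (k + 1) r × Fin k) ⊕ Grp (k + 1) r) z b | Rigid x}.ncard +
      Nat.card (Option (Grp (k + 1) r × Fin k) ⊕ Grp (k + 1) r) := by
  have hN := natCard (C := Grp (k + 1) r) (U := Option (Grp (k + 1) r × Fin k) ⊕ Grp (k + 1) r)
    (z := z) (b := b)
  have hE := ncard_edgeSet_graph (z := z) (b := b)
    (att := attach (root (n := k + 1) (r := r) (k := k)))
  have hatt := natCard_attach_ge (k := k) hr
  have hU : Nat.card (Option (Grp (k + 1) r × Fin k) ⊕ Grp (k + 1) r) =
      Nat.card (Grp (k + 1) r) * k + 1 + Nat.card (Grp (k + 1) r) := by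
    rw [Nat.card_sum, Finite.card_option, Nat.card_prod, Nat.card_fin]
  have hR : {x : GadgetVert (Grp (k + 1) r) (Option (Grp (k + 1) r × Fin k) ⊕ Grp (k + 1) r) z b |
      Rigid x}.ncard + 2 * Nat.card (Grp (k + 1) r) = Nat.card (GadgetVert (Grp (k + 1) r)
        (Option (Grp (k + 1) r × Fin k) ⊕ Grp (k + 1) r) z b) := by
    have := Fintype.ofFinite (Grp (k + 1) r)
    have h1 := ncard_rigid_add (Set.univ : Set (GadgetVert (Grp (k + 1) r)
      (Option (Grp (k + 1) r × Fin k) ⊕ Grp (k + 1) r) z b))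
    rw [ncard_not_rigid, Set.ncard_univ] at h1
    simp only [Set.mem_univ, true_and, ind, if_true, Finset.sum_const, Finset.card_univ,
      smul_eq_mul, mul_one] at h1
    rw [Nat.card_eq_fintype_card (α := Grp (k + 1) r), two_mul]
    exact h1
  rw [hE, ← hR]
  rw [← hR] at hN
  generalize {x : GadgetVert (Grp (k + 1) r)
    (Option (Grp (k + 1) r × Fin k) ⊕ Grp (k + 1) r) z b | Rigid x}.ncard = R at *
  generalize Nat.card (Option (Grp (k + 1) r × Fin k) ⊕ Grp (k + 1) r) = u at *
  generalize Nat.card (Grp (k + 1) r) = N at *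
  generalize Nat.card {p : (Option (Grp (k + 1) r × Fin k) ⊕ Grp (k + 1) r) × Grp (k + 1) r //
    attach root p.1 p.2} = a at *
  nlinarith

theorem theorem1p12 (k D d z : ℕ) (ε : ℝ) (hε : 0 < ε) (hk : 2 ≤ k)
    (hz : (z : ℤ) ≤ ⌊((d : ℝ) - 1) / ((k : ℝ) + 1)⌋) :
    ∃ (V : Type) (_ : Finite V) (G : SimpleGraph V),
      G.fractionalArboricity < (k : ℝ) + (d : ℝ) / ((d : ℝ) + (k : ℝ) + 1) + ε ∧
      ∀ F : Fin (k + 1) → SimpleGraph V,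
        G.IsDecomposition F → (∀ i, (F i).IsPseudoforest) →
        ∀ j : Fin (k + 1), (∀ v : V, ((F j).neighborSet v).encard ≤ (D : ℕ∞)) →
          ∃ K : (F j).ConnectedComponent,
            (d : ℤ) - (z : ℤ) * ((k : ℤ) - 1) + 1 ≤ (K.toSimpleGraph.edgeSet.ncard : ℤ) ∧
            2 * (z + 1) ≤ K.toSimpleGraph.diam := by
  classical
  obtain ⟨b, hb⟩ : ∃ b, d = (k + 1) * z + 1 + b := by
    rw [Int.le_floor, le_div_iff₀ (by positivity)] at hz
    have h : z * (k + 1) + 1 ≤ d := by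
      have : ((z * (k + 1) + 1 : ℕ) : ℝ) ≤ (d : ℕ) := by
        push_cast
        push_cast at hz
        linarith
      exact_mod_cast this
    exact ⟨d - (z * (k + 1) + 1), by rw [mul_comm (k + 1)]; omega⟩
  -- A set with at least `s` vertices absorbs the excess `(k + 1) * (z + 1)` into `ε / 2` per
  -- vertex.
  obtain ⟨s, hs⟩ := exists_nat_ge ((((k + 1) * (z + 1) : ℕ) : ℝ) / (ε / 2))
  -- Then `r / 2 ≥ s` serves the density bound, and the rest of `r` makes the girth large enough.
  obtain ⟨r, hr⟩ : ∃ r, r = 2 * s + (4 * z + b + 4) := ⟨_, rfl⟩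
  obtain ⟨q, hq⟩ := exists_gt (k * k + k * D + k * D * (k * Nat.card (GadgetVert (Grp (k + 1) r)
    (Option (Grp (k + 1) r × Fin k) ⊕ Grp (k + 1) r) z b) + 1))
  refine ⟨Fin k ⊕ (Fin q × GadgetVert (Grp (k + 1) r)
    (Option (Grp (k + 1) r × Fin k) ⊕ Grp (k + 1) r) z b), inferInstance,
    hubGraph k q (graph z b (attach root)) Rigid, ?_, ?_⟩
  · refine lt_of_le_of_lt (hubGraph.fractionalArboricity_le hk
      (θ := (d : ℝ) / ((d : ℝ) + (k : ℝ) + 1) + ε / 2) (by positivity) ?_ ?_) (by linarith)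
    · intro S
      have h1 := mul_edgesIn_le (r := r) (by omega) hb S
      have hm : (0 : ℝ) < (d : ℝ) + k + 1 := by positivity
      have h2 : ((if r / 2 < S.ncard then (k + 1) * (z + 1) else 0 : ℕ) : ℝ) ≤
          ε / 2 * S.ncard := by
        split_ifs with h
        · rw [div_le_iff₀ (by positivity)] at hs
          have h3 : s ≤ S.ncard := by omega
          have h4 : (s : ℝ) ≤ S.ncard := by exact_mod_cast h3
          refine hs.trans ?_
          rw [mul_comm]
          exact mul_le_mul_of_nonneg_left h4 (by positivity)
        · simp only [Nat.cast_zero]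
          positivity
      have h5 : ((d : ℝ) + k + 1) * edgesIn (graph z b (attach root)) S ≤
          k * ((d : ℝ) + k + 1) * {x ∈ S | ¬ Rigid x}.ncard + d * S.ncard + ε / 2 * S.ncard := by
        refine le_trans ?_ (add_le_add_right h2 _)
        exact_mod_cast h1
      have h6 : ε / 2 * S.ncard ≤ ((d : ℝ) + k + 1) * (ε / 2 * S.ncard) :=
        le_mul_of_one_le_left (by positivity) (by
          have : (0 : ℝ) ≤ (d : ℝ) + k := by positivity
          linarith)
      have h7 : ((d : ℝ) + k + 1) * ((d : ℝ) / ((d : ℝ) + (k : ℝ) + 1) * S.ncard) =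
          d * S.ncard := by
        field_simp
      refine le_of_mul_le_mul_left ?_ hm
      rw [add_mul _ (ε / 2), mul_add _ (_ * _), mul_add _ (_ * _), h7]
      linarith
    · exact fun S => two_mul_edgesIn_le root S
  intro F hF hps j hD
  obtain ⟨i, hclean, he⟩ := hubGraph.exists_copy hq hF hps j hD
  have hle : F j ≤ hubGraph k q (graph z b (attach root)) Rigid := by
    rw [← SimpleGraph.edgeSet_subset_edgeSet, ← hF.2]
    exact Set.subset_iUnion (fun i => (F i).edgeSet) j
  have hex := excess (k := k) (r := r) (by omega) z b
  obtain ⟨K', hK1, hK2⟩ := exists_large_component (F := (F j).comap (hubGraph.copy k i))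
    (hubGraph.comap_copy_le hle i)
    (fun u w hw => by have := lt_length_of_isCycle _ w hw; omega) (by omega)
  obtain ⟨K, ⟨φ⟩⟩ := K'.exists_iso_of_comap (hubGraph.copy k i) (by
    rintro x (h | ⟨i', y⟩) hxy
    · exact (hclean h x hxy.symm).elim
    · have : i = i' := (hle hxy).1
      subst this
      exact ⟨y, rfl⟩)
  refine ⟨K, ?_, ?_⟩
  · rw [← φ.ncard_edgeSet_eq]
    have h1 : ((2 * z + 2 + b : ℕ) : ℤ) ≤ (K'.toSimpleGraph.edgeSet.ncard : ℤ) := by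
      exact_mod_cast hK1
    refine le_trans (le_of_eq ?_) h1
    rw [hb]
    push_cast
    ring
  · rwa [← φ.diam_eq]
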